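/- For signs $\varepsilon_j,\sigma_j\in\{\pm1\}$ and positive integers $s_j$ let \[ M^{\varepsilon_1,\ldots,\varepsilon_r}_{\sigma_1,\ldots,\sigma_r}(s_1,\ldots,s_r)=\sum_{n_1>\cdots>n_r>0}\ \prod_{j=1}^r\frac{(1+\varepsilon_j(-1)^{n_j})\,\sigma_j^{(2n_j+1-\varepsilon_j)/4}}{n_j^{s_j}}, \] and let $S^{\sigma_1,\ldots,\sigma_r}(s_1,\ldots,s_r)$ be this value with $\varepsilon_j=(-1)^{r-j}$ (so that $n_r$ is even, $n_{r-1}$ odd, and so on alternately). A bar over $s_j$ means $\sigma_j=-1$, no bar means $\sigma_j=1$, and $\{1\}_n$ means $n$ repetitions of $1$. Let \[ \beta(s)=\sum_{n\ge1}\frac{(-1)^{n-1}}{(2n-1)^s},\qquad \mathrm{Li}_{s_1,\ldots,s_r}(x_1,\ldots,x_r)=\sum_{n_1>\cdots>n_r>0}\frac{x_1^{n_1}\cdots x_r^{n_r}}{n_1^{s_1}\cdots n_r^{s_r}}, \] where every nested sum is understood as the limit for $N\to\infty$ of its truncation to $n_1<N$, and $\beta(s)$ as the limit of its partial sums. Theorem.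 For every integer $m\ge1$ all the series below converge (as do those for $\beta(s)$, $\mathrm{Li}_s(i)$ and $\mathrm{Li}_s(-1)$ for every integer $s\ge1$), and \begin{align*} S(\overline{2},\{1\}_{m-1},1)=i^{\delta}\bigg[ &\sum_{\substack{p+r=m\\p,r\ge0}}2i(-1)^{p+1}\beta(r+1)\cdot2\,\mathrm{Li}_{p+1}(i) +\sum_{\substack{k+r=m\\k,r\ge0}}2i\,\beta(r+1)\frac{1}{(k+1)!}\Big(\frac{i\pi}{2}\Big)^{k+1}\\ &-\sum_{\substack{k+p+r=m\\k,p,r\ge0}}2i(-1)^{p+1}\beta(r+1)\cdot2\,\mathrm{Li}_{p+1}(-1)\cdot\frac{1}{k!}\Big(\frac{i\pi}{2}\Big)^{k} +2i\,\beta(m+2)-\mathrm{Li}_{m+2}(-1)+\mathrm{Li}_{m+2}(1)\\ &-2\,\mathrm{Li}_{1,m+1}(i,-1)+2\,\mathrm{Li}_{1,m+1}(i,1)+2\,\mathrm{Li}_{1,m+1}(-1,-1)-2\,\mathrm{Li}_{1,m+1}(-1,1)\bigg], \end{align*} where $\delta=1$ if $m$ is odd and $\delta=0$ if $m$ is even.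 -/

import Mathlib

/-- The truncated nested sum `∑_{N > n₁ > n₂ > ⋯ > n_r > 0} f₁(n₁) f₂(n₂) ⋯ f_r(n_r)`
of a list `[f₁, …, f_r]`, by recursion on the outermost (largest) index `n₁`. -/
def nestedSum {R : Type*} [CommSemiring R] : List (ℕ → R) → ℕ → R
  | [], _ => 1
  | f :: fs, N => ∑ n ∈ Finset.Ico 1 N, f n * nestedSum fs n

/-- The summand functions `n ↦ xⱼ ^ n / n ^ sⱼ` of a multiple polylogarithm; the list holds the
pairs `(sⱼ, xⱼ)`. -/
noncomputable def liTerms (l : List (ℕ × ℂ)) : List (ℕ → ℂ) :=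
  l.map fun q n => q.2 ^ n / (n : ℂ) ^ q.1

/-- The series of the multiple polylogarithm converges, as the limit of its truncations at
`n₁ < N`. -/
def MultiLiConverges (l : List (ℕ × ℂ)) : Prop :=
  ∃ L : ℂ, Filter.Tendsto (nestedSum (liTerms l)) Filter.atTop (nhds L)

/-- The multiple polylogarithm
`Li_{s₁,…,s_r}(x₁,…,x_r) = ∑_{n₁ > ⋯ > n_r > 0} x₁^{n₁} ⋯ x_r^{n_r} / (n₁^{s₁} ⋯ n_r^{s_r})`,
written `multiLi [(s₁, x₁), …, (s_r, x_r)]`; the value of the (possibly only conditionally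
convergent) series is the limit of its truncations at `n₁ < N` as `N → ∞`. -/
noncomputable def multiLi (l : List (ℕ × ℂ)) : ℂ :=
  Filter.limUnder Filter.atTop (nestedSum (liTerms l))

/-- Partial sums of the series `∑_{n ≥ 0} (-1)^n / (2n+1)^s`. -/
noncomputable def betaPartial (s : ℕ) (N : ℕ) : ℝ :=
  ∑ n ∈ Finset.range N, (-1) ^ n / (2 * (n : ℝ) + 1) ^ s

/-- The series of the Dirichlet beta value `β(s)` converges. -/
def DirichletBetaConverges (s : ℕ) : Prop :=
  ∃ L : ℝ, Filter.Tendsto (betaPartial s) Filter.atTop (nhds L)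

/-- The Dirichlet beta value `β(s) = ∑_{n ≥ 1} (-1)^{n-1} / (2n-1)^s` at a positive integer `s`
(conditionally convergent for `s = 1`). -/
noncomputable def dirichletBeta (s : ℕ) : ℝ :=
  Filter.limUnder Filter.atTop (betaPartial s)

/-- The summand functions `n ↦ (1 + ε (-1)^n) σ^{(2n+1-ε)/4} / n^s` of an alternating multiple
mixed value; the list holds the triples `(ε, σ, s)`. The factor `1 + ε (-1)^n` vanishes unless
`n` is even (`ε = 1`) or odd (`ε = -1`), and in these cases the division by `4` is exact. -/
noncomputable def mixedTerms (l : List (ℤˣ × ℤˣ × ℕ)) : List (ℕ → ℝ) :=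
  l.map fun q n =>
    (1 + (((q.1 : ℤˣ) : ℤ) : ℝ) * (-1) ^ n) *
      (((q.2.1 ^ ((2 * (n : ℤ) + 1 - ((q.1 : ℤˣ) : ℤ)) / 4) : ℤˣ) : ℤ) : ℝ) / (n : ℝ) ^ q.2.2

/-- The series of the alternating multiple mixed value converges. -/
def MixedConverges (l : List (ℤˣ × ℤˣ × ℕ)) : Prop :=
  ∃ L : ℝ, Filter.Tendsto (nestedSum (mixedTerms l)) Filter.atTop (nhds L)

/-- The alternating multiple mixed value `M^{ε₁,…,ε_r}_{σ₁,…,σ_r}(s₁,…,s_r)`, written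
`mixedValue [(ε₁, σ₁, s₁), …, (ε_r, σ_r, s_r)]`. -/
noncomputable def mixedValue (l : List (ℤˣ × ℤˣ × ℕ)) : ℝ :=
  Filter.limUnder Filter.atTop (nestedSum (mixedTerms l))

/-- Attach to a list of pairs `(σⱼ, sⱼ)` the alternating parities `…, od, ev, od, ev` that end in
`ev = 1` (with `od = -1`). -/
def withSParities : List (ℤˣ × ℕ) → List (ℤˣ × ℤˣ × ℕ)
  | [] => []
  | q :: l => ((-1) ^ l.length, q.1, q.2) :: withSParities l

/-- The series of the alternating multiple `S` value converges. -/
def MultiSConverges (l : List (ℤˣ × ℕ)) : Prop :=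
  MixedConverges (withSParities l)

/-- The alternating multiple `S` value `S^{σ₁,…,σ_r}(s₁,…,s_r)`, written
`multiS [(σ₁, s₁), …, (σ_r, s_r)]`; a barred argument has sign `-1`. -/
noncomputable def multiS (l : List (ℤˣ × ℕ)) : ℝ :=
  mixedValue (withSParities l)

/-- The arguments `(2̄, {1}_{m-1}, 1)`. -/
def argsBarTwoOnes (m : ℕ) : List (ℤˣ × ℕ) :=
  (-1, 2) :: (List.replicate (m - 1) (1, 1) ++ [(1, 1)])

/-! Put `A_j(x) = ∑ altCoeff j n x^n`. Passing from depth `j` to `j + 1` means integrating against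
`2 dx / (1 - x²)`, starting from `A_0 = x`, and the sum to be evaluated is `I^δ` times `∑ altCoeff
(m + 1) n / n * x^n` at `x = i`, that is, one further integration against `dx / x`.

The substitution `x = (1 - v) / (1 + v)` turns `2 dx / (1 - x²)` into `-dv / v`, so every `A_j`
becomes a polynomial in `-log v` plus a multiple of `Li_j(-v)`, with constants `Li_p(-1)` fixed by
vanishing at `v = 1` (`altFun_eq_logLi`). The last form `dx / x` becomes `liOdd 0 v dv / v`, where
`liOdd s v = Li_s(-v) - Li_s(v)`. Repeated integration by parts moves the integrations from
`A_{m+1}` to `liOdd`: the boundary terms are the products in `productSum`, and the remaining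
integrand `liOdd (m + 1) v * cayley v / v` has an elementary antiderivative `-liDepthTwo` in
polylogarithms of depth at most two.

Hence `sFun - productSum + liDepthTwo` is constant on `lens` (`hasDerivAt_sFun_sub_productSum`). Its
limits at `v = 1` (where `x = 0`) and at `v = -i` (where `x = i`) agree; the first contributes only
depth-two constants, the second holds the wanted value (`limit_sFun_eq`). Several series converge
only conditionally on the circle, so the limits come from Abel's theorem along paths inside a Stolz
set (`tendsto_powerSum`). -/

namespace AltMixed

open Filter Topology Finset

/-! ### Power series in the unit disc: derivatives, recursions, Abel limits. -/

/-- The sum of the power series with coefficients `a`. -/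
noncomputable def powerSum (a : ℕ → ℂ) (z : ℂ) : ℂ := ∑' n, a n * z ^ n

/-- Coefficient sequences of at most linear growth. -/
def LinearlyBounded (a : ℕ → ℂ) : Prop := ∃ C : ℝ, ∀ n : ℕ, ‖a n‖ ≤ C * (n + 1)

lemma summable_succ_mul_geometric {r : ℝ} (h0 : 0 ≤ r) (h1 : r < 1) :
    Summable fun n : ℕ => ((n : ℝ) + 1) * r ^ n := by
  have hr : ‖r‖ < 1 := by rwa [Real.norm_of_nonneg h0]
  have h := (summable_pow_mul_geometric_of_norm_lt_one 1 hr).add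
    (summable_geometric_of_norm_lt_one hr)
  refine h.congr fun n => ?_
  ring

lemma LinearlyBounded.summable {a : ℕ → ℂ} (ha : LinearlyBounded a) {z : ℂ} (hz : ‖z‖ < 1) :
    Summable fun n => a n * z ^ n := by
  obtain ⟨C, hC⟩ := ha
  refine Summable.of_norm_bounded ((summable_succ_mul_geometric (norm_nonneg z) hz).mul_left C)
    fun n => ?_
  rw [norm_mul, norm_pow, ← mul_assoc]
  exact mul_le_mul_of_nonneg_right (hC n) (by positivity)

lemma LinearlyBounded.of_nat_mul {a b : ℕ → ℂ} (hb : LinearlyBounded b)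
    (hab : ∀ n : ℕ, (n : ℂ) * a n = b n) : LinearlyBounded a := by
  obtain ⟨C, hC⟩ := hb
  have hC0 : 0 ≤ C := by have := (norm_nonneg _).trans (hC 0); simpa using this
  refine ⟨C + ‖a 0‖, fun n => ?_⟩
  rcases Nat.eq_zero_or_pos n with rfl | hn
  · simp [hC0]
  · have h1 : (1 : ℝ) ≤ n := by exact_mod_cast hn
    have h2 : ‖a n‖ ≤ ‖b n‖ := by
      rw [← hab n, norm_mul, Complex.norm_natCast]
      exact le_mul_of_one_le_left (norm_nonneg _) h1
    have := hC n
    nlinarith [norm_nonneg (a 0)]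

/-- Termwise differentiation, written without dividing by `z`, so that it also applies at the centre
`z = 0`, which is the point `x = 0` reached as `v → 1`. -/
lemma hasDerivAt_powerSum_nat_mul {a b : ℕ → ℂ} (hb : LinearlyBounded b)
    (hab : ∀ n : ℕ, (n : ℂ) * a n = b n) {z : ℂ} (hz : ‖z‖ < 1) :
    HasDerivAt (powerSum a) (∑' n, b n * z ^ (n - 1)) z := by
  have hasum := (hb.of_nat_mul hab)
  obtain ⟨C, hC⟩ := id hb
  obtain ⟨r, hr1, hr2⟩ := exists_between hz
  have hr0 : 0 < r := (norm_nonneg z).trans_lt hr1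
  have hu : Summable fun n : ℕ => C * (((n : ℝ) + 1) * r ^ n) * r⁻¹ :=
    ((summable_succ_mul_geometric hr0.le hr2).mul_left C).mul_right _
  have hz0 : (0 : ℂ) ∈ Metric.ball (0 : ℂ) r := Metric.mem_ball_self hr0
  refine hasDerivAt_tsum_of_isPreconnected (t := Metric.ball (0 : ℂ) r) hu Metric.isOpen_ball
    (convex_ball (0 : ℂ) r).isPreconnected (g := fun n y => a n * y ^ n)
    (g' := fun n y => b n * y ^ (n - 1)) (fun n y _ => ?_) (fun n y hy => ?_) hz0
    (hasum.summable (by simp)) (by simpa using hr1)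
  · rw [← hab n]
    have := (hasDerivAt_pow n y).const_mul (a n)
    exact this.congr_deriv (by ring)
  · have hy' : ‖y‖ ≤ r := by simpa using (Metric.mem_ball.1 hy).le
    rcases Nat.eq_zero_or_pos n with rfl | hn
    · have : b 0 = 0 := by rw [← hab 0]; simp
      have hC0 : 0 ≤ C := by have := (norm_nonneg _).trans (hC 0); simpa using this
      simp only [this, zero_mul, norm_zero]
      positivity
    · rw [norm_mul, norm_pow]
      have h1 : r ^ n * r⁻¹ = r ^ (n - 1) := by
        obtain ⟨k, rfl⟩ := Nat.exists_eq_succ_of_ne_zero hn.ne'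
        rw [Nat.succ_sub_one, pow_succ, mul_assoc, mul_inv_cancel₀ hr0.ne', mul_one]
      rw [mul_assoc, mul_assoc, h1, ← mul_assoc]
      have hCn : 0 ≤ C * ((n : ℝ) + 1) := (norm_nonneg _).trans (hC n)
      gcongr
      exact hC n

lemma hasDerivAt_powerSum {a b : ℕ → ℂ} (hb : LinearlyBounded b)
    (hab : ∀ n : ℕ, (n : ℂ) * a n = b n) {z : ℂ} (hz : ‖z‖ < 1) (hz0 : z ≠ 0) :
    HasDerivAt (powerSum a) (powerSum b z / z) z := by
  convert hasDerivAt_powerSum_nat_mul hb hab hz using 1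
  rw [powerSum, ← tsum_div_const]
  refine tsum_congr fun n => ?_
  rcases Nat.eq_zero_or_pos n with rfl | hn
  · have : b 0 = 0 := by rw [← hab 0]; simp
    simp [this]
  · obtain ⟨k, rfl⟩ := Nat.exists_eq_succ_of_ne_zero hn.ne'
    rw [Nat.succ_sub_one, pow_succ]
    field_simp

lemma powerSum_zero {a : ℕ → ℂ} (h : a 0 = 0) : powerSum a 0 = 0 := by
  rw [powerSum, tsum_eq_single 0 fun n hn => by simp [hn]]
  simp [h]

/-- Two terms of a recursion with step two, at the level of generating functions. -/
lemma powerSum_of_step_two {u t : ℕ → ℂ} (hu : LinearlyBounded u) (ht : LinearlyBounded t)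
    (h0 : u 0 = 0) (h1 : u 1 = 0) (ht0 : t 0 = 0) (h : ∀ n, u (n + 2) = u n + 2 * t (n + 1))
    {z : ℂ} (hz : ‖z‖ < 1) :
    (1 - z ^ 2) * powerSum u z = 2 * z * powerSum t z := by
  have hus := hu.summable hz
  have hts := ht.summable hz
  have e1 : powerSum u z = ∑' n, u (n + 2) * z ^ (n + 2) := by
    rw [powerSum, ← hus.sum_add_tsum_nat_add 2]
    simp [Finset.sum_range_succ, h0, h1]
  have e2 : powerSum t z = ∑' n, t (n + 1) * z ^ (n + 1) := by
    rw [powerSum, ← hts.sum_add_tsum_nat_add 1]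
    simp [ht0]
  have e3 : ∑' n, u (n + 2) * z ^ (n + 2)
      = z ^ 2 * (∑' n, u n * z ^ n) + 2 * z * ∑' n, t (n + 1) * z ^ (n + 1) := by
    rw [← tsum_mul_left, ← tsum_mul_left, ← (hus.mul_left _).tsum_add
      (((summable_nat_add_iff 1).2 hts).mul_left _)]
    refine tsum_congr fun n => ?_
    rw [h n]
    ring
  have e4 : powerSum u z = z ^ 2 * powerSum u z + 2 * z * powerSum t z := by
    conv_lhs => rw [e1, e3]
    rw [e2, powerSum]
  linear_combination e4

/-- Summing the recursion against `z^(n+1)`; the factor `1 - x * z` becomes the kernel in the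
derivative of the double polylogarithm. -/
lemma powerSum_of_step_one {c t : ℕ → ℂ} (hc : LinearlyBounded c) (ht : LinearlyBounded t)
    (x : ℂ) (h0 : c 0 = 0) (h : ∀ n, c (n + 1) = x * c n + x * t n) {z : ℂ} (hz : ‖z‖ < 1) :
    (1 - x * z) * powerSum c z = x * z * powerSum t z := by
  have hcs := hc.summable hz
  have hts := ht.summable hz
  have e1 : powerSum c z = ∑' n, c (n + 1) * z ^ (n + 1) := by
    rw [powerSum, ← hcs.sum_add_tsum_nat_add 1]
    simp [h0]
  have e3 : ∑' n, c (n + 1) * z ^ (n + 1)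
      = x * z * (∑' n, c n * z ^ n) + x * z * ∑' n, t n * z ^ n := by
    rw [← tsum_mul_left, ← tsum_mul_left, ← (hcs.mul_left _).tsum_add (hts.mul_left _)]
    refine tsum_congr fun n => ?_
    rw [h n]
    ring
  have e4 : powerSum c z = x * z * powerSum c z + x * z * powerSum t z := by
    conv_lhs => rw [e1, e3]
    rfl
  linear_combination e4

/-- Abel's limit theorem along a filter approaching a boundary point inside a Stolz set. -/
lemma tendsto_powerSum {ι : Type*} {F : Filter ι} {v : ι → ℂ} {a : ℕ → ℂ} {ζ L : ℂ} (M : ℝ)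
    (hζ : ‖ζ‖ = 1) (ha : Tendsto (fun N => ∑ n ∈ range N, a n * ζ ^ n) atTop (𝓝 L))
    (hv : Tendsto v F (𝓝 ζ)) (hM : ∀ᶠ t in F, ‖v t‖ < 1 ∧ ‖ζ - v t‖ < M * (1 - ‖v t‖)) :
    Tendsto (fun t => powerSum a (v t)) F (𝓝 L) := by
  have hζ0 : ζ ≠ 0 := by rintro rfl; simp at hζ
  -- Rotating by `ζ` moves the boundary point to `1`; since `‖ζ‖ = 1`, the Stolz condition is
  -- unchanged.
  have h1 : Tendsto (fun t => v t / ζ) F (𝓝[Complex.stolzSet M] 1) := by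
    refine tendsto_nhdsWithin_iff.2 ⟨?_, ?_⟩
    · have := hv.div_const ζ
      rwa [div_self hζ0] at this
    · filter_upwards [hM] with t ht
      have e : 1 - v t / ζ = (ζ - v t) / ζ := by field_simp
      refine ⟨?_, ?_⟩
      · rw [norm_div, hζ, div_one]; exact ht.1
      · rw [e, norm_div, norm_div, hζ, div_one, div_one]; exact ht.2
  refine ((Complex.tendsto_tsum_powerSeries_nhdsWithin_stolzSet ha (M := M)).comp h1).congr
    fun t => ?_
  refine tsum_congr fun n => ?_
  rw [div_pow, mul_assoc, mul_div_cancel₀ _ (pow_ne_zero n hζ0)]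

/-! ### Polylogarithm coefficients. -/

/-- The coefficients `1 / n ^ s` of the polylogarithm, with constant term zero. -/
noncomputable def liCoeff (s n : ℕ) : ℂ := if n = 0 then 0 else 1 / (n : ℂ) ^ s

lemma nat_mul_liCoeff (s n : ℕ) : (n : ℂ) * liCoeff (s + 1) n = liCoeff s n := by
  unfold liCoeff
  split_ifs with h
  · simp
  · have : (n : ℂ) ≠ 0 := by exact_mod_cast h
    field_simp
    ring

lemma norm_liCoeff_le (s n : ℕ) : ‖liCoeff s n‖ ≤ 1 := by
  unfold liCoeff
  split_ifs with h
  · simp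
  · have h1 : (1 : ℝ) ≤ (n : ℝ) ^ s := one_le_pow₀ (by exact_mod_cast Nat.one_le_iff_ne_zero.2 h)
    rw [norm_div, norm_one, norm_pow, Complex.norm_natCast]
    exact div_le_one_of_le₀ h1 (by positivity)

lemma LinearlyBounded.of_norm_le_one {a : ℕ → ℂ} (h : ∀ n, ‖a n‖ ≤ 1) : LinearlyBounded a :=
  ⟨1, fun n => (h n).trans (by have : (0 : ℝ) ≤ n := n.cast_nonneg
                               linarith)⟩

lemma linearlyBounded_liCoeff (s : ℕ) : LinearlyBounded (liCoeff s) :=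
  .of_norm_le_one (norm_liCoeff_le s)

lemma powerSum_liCoeff_zero {z : ℂ} (hz : ‖z‖ < 1) : powerSum (liCoeff 0) z = z / (1 - z) := by
  have h := tsum_geometric_of_norm_lt_one hz
  have hs : Summable fun n => liCoeff 0 n * z ^ n := (linearlyBounded_liCoeff 0).summable hz
  rw [powerSum, ← hs.sum_add_tsum_nat_add 1, div_eq_mul_inv, ← h, ← tsum_mul_left]
  simp [liCoeff, pow_succ']

/-! ### Alternating-parity harmonic sums: growth and recursion. -/

/-- The nested sums over alternating parities, the smallest index even, of the products
`∏ 2 / n_j`. -/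
noncomputable def altHarm : ℕ → ℕ → ℝ
  | 0, _ => 1
  | j + 1, N => ∑ n ∈ Ico 1 N, (1 + (-1) ^ (j + n)) / (n : ℝ) * altHarm j n

/-- The coefficients of the generating function of `altHarm`, shifted by one in depth. -/
noncomputable def altCoeff : ℕ → ℕ → ℂ
  | 0, n => if n = 1 then 1 else 0
  | j + 1, n => ((1 + (-1) ^ (j + n)) / (n : ℝ) * altHarm j n : ℝ)

lemma one_add_neg_one_pow_mem (k : ℕ) :
    (0 : ℝ) ≤ 1 + (-1) ^ k ∧ (1 : ℝ) + (-1) ^ k ≤ 2 := by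
  rcases neg_one_pow_eq_or ℝ k with h | h <;> rw [h] <;> norm_num

lemma sum_inv_sqrt_le (n : ℕ) : ∑ k ∈ Ico 1 n, 1 / √(k : ℝ) ≤ 3 * √(n : ℝ) := by
  induction n with
  | zero => simp
  | succ n ih =>
    rcases Nat.eq_zero_or_pos n with rfl | hn
    · simp
    rw [Finset.sum_Ico_succ_top hn]
    have h0 : (0 : ℝ) < n := by exact_mod_cast hn
    have h1 : (1 : ℝ) ≤ n := by exact_mod_cast hn
    have hs : 0 < √(n : ℝ) := Real.sqrt_pos.2 h0
    have hs2 : √(n : ℝ) ^ 2 = n := Real.sq_sqrt h0.le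
    set s := √(n : ℝ)
    -- The constant `3` leaves slack: the square of the left side is `n + 2/3 + 1/(9n) ≤ n + 7/9`.
    -- With `2` in place of `3` it would exceed `n + 1`.
    have h2 : s + 1 / (3 * s) ≤ √((n + 1 : ℕ) : ℝ) := by
      apply Real.le_sqrt_of_sq_le
      have e : (s + 1 / (3 * s)) ^ 2 = s ^ 2 + 2 / 3 + (1 / (3 * s)) ^ 2 := by field_simp; ring
      have h3 : (1 / (3 * s)) ^ 2 ≤ 1 / 9 := by
        have : (1 / (3 * s)) ^ 2 = 1 / (9 * s ^ 2) := by field_simp; ring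
        rw [this, hs2]
        exact one_div_le_one_div_of_le (by norm_num) (by linarith)
      push_cast
      rw [e, hs2]
      linarith
    have h4 : 3 * (s + 1 / (3 * s)) = 3 * s + 1 / s := by field_simp
    linarith

/-- The bound `√n` is crude, but it reproduces itself under `∑ 1/k` at each depth and leaves terms
of order `n^(-3/2)` after division by `n²`, which is summable. -/
lemma exists_altHarm_le (j : ℕ) :
    ∃ C : ℝ, 0 ≤ C ∧ ∀ n : ℕ, 1 ≤ n → 0 ≤ altHarm j n ∧ altHarm j n ≤ C * √(n : ℝ) := by
  induction j with
  | zero =>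
    refine ⟨1, zero_le_one, fun n hn => ⟨zero_le_one, ?_⟩⟩
    rw [one_mul, altHarm]
    exact Real.one_le_sqrt.2 (by exact_mod_cast hn)
  | succ j ih =>
    obtain ⟨C, hC, h⟩ := ih
    refine ⟨2 * C * 3, by positivity, fun n _ => ⟨?_, ?_⟩⟩
    · refine Finset.sum_nonneg fun k hk => ?_
      have := one_add_neg_one_pow_mem (j + k)
      exact mul_nonneg (div_nonneg this.1 k.cast_nonneg) (h k (Finset.mem_Ico.1 hk).1).1
    · rw [altHarm, mul_assoc]
      refine le_trans ?_ (mul_le_mul_of_nonneg_left (sum_inv_sqrt_le n) (by positivity))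
      rw [Finset.mul_sum]
      refine Finset.sum_le_sum fun k hk => ?_
      have hk1 := (Finset.mem_Ico.1 hk).1
      have hk0 : (0 : ℝ) < k := by exact_mod_cast hk1
      have hp := one_add_neg_one_pow_mem (j + k)
      have e : 2 * C * (1 / √(k : ℝ)) = 2 / (k : ℝ) * (C * √(k : ℝ)) := by
        have hs := Real.sqrt_pos.2 hk0
        have := Real.sq_sqrt hk0.le
        field_simp
        rw [this]
      rw [e]
      exact mul_le_mul (div_le_div_of_nonneg_right hp.2 hk0.le) (h k hk1).2 (h k hk1).1
        (by positivity)

lemma altCoeff_succ_zero (j : ℕ) : altCoeff (j + 1) 0 = 0 := by simp [altCoeff]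

lemma altCoeff_zero (j : ℕ) : altCoeff j 0 = 0 := by
  cases j with
  | zero => simp [altCoeff]
  | succ j => exact altCoeff_succ_zero j

lemma exists_norm_nat_mul_altCoeff_le (j : ℕ) :
    ∃ C : ℝ, 0 ≤ C ∧ ∀ n : ℕ, ‖(n : ℂ) * altCoeff (j + 1) n‖ ≤ C * √(n : ℝ) := by
  obtain ⟨C, hC, h⟩ := exists_altHarm_le j
  refine ⟨2 * C, by positivity, fun n => ?_⟩
  rcases Nat.eq_zero_or_pos n with rfl | hn
  · simp
  have hn0 : (0 : ℝ) < n := by exact_mod_cast hn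
  have hp := one_add_neg_one_pow_mem (j + n)
  have e : (n : ℂ) * altCoeff (j + 1) n = ((1 + (-1) ^ (j + n)) * altHarm j n : ℝ) := by
    rw [altCoeff]
    have : (n : ℂ) ≠ 0 := by exact_mod_cast hn.ne'
    push_cast
    field_simp
  rw [e, Complex.norm_real, Real.norm_of_nonneg (mul_nonneg hp.1 (h n hn).1), mul_assoc]
  exact mul_le_mul hp.2 (h n hn).2 (h n hn).1 (by norm_num)

lemma linearlyBounded_nat_mul_altCoeff (j : ℕ) :
    LinearlyBounded fun n => (n : ℂ) * altCoeff (j + 1) n := by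
  obtain ⟨C, hC, h⟩ := exists_norm_nat_mul_altCoeff_le j
  refine ⟨C, fun n => (h n).trans (mul_le_mul_of_nonneg_left ?_ hC)⟩
  rw [Real.sqrt_le_left (by positivity)]
  nlinarith [(Nat.cast_nonneg n : (0 : ℝ) ≤ n)]

lemma linearlyBounded_altCoeff (j : ℕ) : LinearlyBounded (altCoeff j) := by
  cases j with
  | zero => exact .of_norm_le_one fun n => by rw [altCoeff]; split_ifs <;> simp
  | succ j => exact (linearlyBounded_nat_mul_altCoeff j).of_nat_mul fun n => rfl

lemma nat_mul_altCoeff_one (j : ℕ) : ((1 : ℕ) : ℂ) * altCoeff (j + 1) 1 = 0 := by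
  cases j <;> simp [altCoeff, altHarm]

/-- Moving from `n` to `n + 2` keeps the outer parity and adds the inner indices `n` and `n + 1`;
when the outer factor is nonzero, only `n + 1` has the admissible parity. This is the coefficient
form of `A_{j+1}' = 2 A_j / (1 - x²)`. -/
lemma nat_mul_altCoeff_add_two (j n : ℕ) :
    ((n + 2 : ℕ) : ℂ) * altCoeff (j + 1) (n + 2) =
      n * altCoeff (j + 1) n + 2 * altCoeff j (n + 1) := by
  -- At `n = 0` this formula fails for `j = 0` (left `0`, right `2`), hence the separate treatment
  -- of `n = 0` below.
  have e : ∀ j n : ℕ, n ≠ 0 →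
      (n : ℂ) * altCoeff (j + 1) n = ((1 + (-1) ^ (j + n)) * altHarm j n : ℝ) := by
    intro j n hn
    have : (n : ℂ) ≠ 0 := by exact_mod_cast hn
    rw [altCoeff]
    push_cast
    field_simp
  rw [e _ _ (by omega)]
  cases j with
  | zero =>
    rcases Nat.eq_zero_or_pos n with rfl | hn
    · simp [altCoeff, altHarm]; norm_num
    · rw [e _ _ hn.ne']
      simp [altCoeff, altHarm, pow_add, hn.ne']
  | succ j =>
    rcases Nat.eq_zero_or_pos n with rfl | hn
    · simp only [altCoeff, altHarm]
      simp [pow_succ]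
      rcases neg_one_pow_eq_or ℂ j with h | h <;> rw [h] <;> norm_num
    · rw [e _ _ hn.ne', altCoeff]
      have hs : altHarm (j + 1) (n + 2) = altHarm (j + 1) n
          + (1 + (-1) ^ (j + n)) / (n : ℝ) * altHarm j n
          + (1 + (-1) ^ (j + (n + 1))) / ((n + 1 : ℕ) : ℝ) * altHarm j (n + 1) := by
        simp only [altHarm]
        rw [Finset.sum_Ico_succ_top (by omega), Finset.sum_Ico_succ_top (by omega)]
      have h1 : ((-1 : ℝ)) ^ (j + 1 + (n + 2)) = -(-1) ^ (j + n) := by ring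
      have h2 : ((-1 : ℝ)) ^ (j + 1 + n) = -(-1) ^ (j + n) := by ring
      have h3 : ((-1 : ℝ)) ^ (j + (n + 1)) = -(-1) ^ (j + n) := by ring
      have key : (1 + (-1) ^ (j + 1 + (n + 2))) * altHarm (j + 1) (n + 2)
          = (1 + (-1) ^ (j + 1 + n)) * altHarm (j + 1) n
            + 2 * ((1 + (-1) ^ (j + (n + 1))) / ((n + 1 : ℕ) : ℝ) * altHarm j (n + 1)) := by
        rw [hs, h1, h2, h3]
        rcases neg_one_pow_eq_or ℝ (j + n) with h | h <;> rw [h] <;> ring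
      rw [key, Complex.ofReal_add, Complex.ofReal_mul 2, Complex.ofReal_ofNat]

lemma powerSum_altCoeff_zero (z : ℂ) : powerSum (altCoeff 0) z = z := by
  rw [powerSum, tsum_eq_single 1 fun n hn => by simp [altCoeff, hn]]
  simp [altCoeff]

lemma powerSum_nat_mul_altCoeff (j : ℕ) {z : ℂ} (hz : ‖z‖ < 1) :
    (1 - z ^ 2) * powerSum (fun n => (n : ℂ) * altCoeff (j + 1) n) z
      = 2 * z * powerSum (altCoeff j) z :=
  powerSum_of_step_two (linearlyBounded_nat_mul_altCoeff j) (linearlyBounded_altCoeff j)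
    (by simp) (nat_mul_altCoeff_one j) (altCoeff_zero j) (nat_mul_altCoeff_add_two j) hz

/-! ### Generating function of the double polylogarithm. -/

/-- The coefficients of the double polylogarithm `Li_{1,s}(x, y)` in powers of the variable. -/
noncomputable def liTwoCoeff (x y : ℂ) (s n : ℕ) : ℂ :=
  x ^ n / n * ∑ k ∈ range n, liCoeff s k * y ^ k

lemma linearlyBounded_nat_mul_liTwoCoeff {x y : ℂ} (hx : ‖x‖ ≤ 1) (hy : ‖y‖ ≤ 1) (s : ℕ) :
    LinearlyBounded fun n => (n : ℂ) * liTwoCoeff x y s n := by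
  refine ⟨1, fun n => ?_⟩
  rcases Nat.eq_zero_or_pos n with rfl | hn
  · simp
  have hn0 : (n : ℂ) ≠ 0 := by exact_mod_cast hn.ne'
  have e : (n : ℂ) * liTwoCoeff x y s n = x ^ n * ∑ k ∈ range n, liCoeff s k * y ^ k := by
    rw [liTwoCoeff]; field_simp
  have h1 : ‖∑ k ∈ range n, liCoeff s k * y ^ k‖ ≤ n := by
    refine (norm_sum_le_of_le (range n) (f := fun k => liCoeff s k * y ^ k) (n := fun _ => 1)
      fun k _ => ?_).trans (by simp)
    rw [norm_mul, norm_pow]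
    exact mul_le_one₀ (norm_liCoeff_le s k) (by positivity) (pow_le_one₀ (norm_nonneg _) hy)
  change ‖(n : ℂ) * liTwoCoeff x y s n‖ ≤ _
  rw [e, norm_mul, norm_pow]
  have h2 : ‖x‖ ^ n ≤ 1 := pow_le_one₀ (norm_nonneg _) hx
  nlinarith [norm_nonneg (∑ k ∈ range n, liCoeff s k * y ^ k)]

lemma powerSum_nat_mul_liTwoCoeff {x y : ℂ} (hx : ‖x‖ ≤ 1) (hy : ‖y‖ ≤ 1) (s : ℕ) {z : ℂ}
    (hz : ‖z‖ < 1) :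
    (1 - x * z) * powerSum (fun n => (n : ℂ) * liTwoCoeff x y s n) z
      = x * z * powerSum (liCoeff s) (x * y * z) := by
  have ht : LinearlyBounded fun n => x ^ n * (liCoeff s n * y ^ n) := by
    refine .of_norm_le_one fun n => ?_
    rw [norm_mul, norm_mul, norm_pow, norm_pow]
    exact mul_le_one₀ (pow_le_one₀ (norm_nonneg _) hx) (by positivity)
      (mul_le_one₀ (norm_liCoeff_le s n) (by positivity) (pow_le_one₀ (norm_nonneg _) hy))
  rw [powerSum_of_step_one (linearlyBounded_nat_mul_liTwoCoeff hx hy s) ht x (by simp) ?_ hz]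
  · congr 1
    refine tsum_congr fun n => ?_
    rw [mul_pow, mul_pow]
    ring
  · intro n
    rcases Nat.eq_zero_or_pos n with rfl | hn
    · simp [liTwoCoeff, liCoeff]
    have hn0 : (n : ℂ) ≠ 0 := by exact_mod_cast hn.ne'
    have hn1 : ((n + 1 : ℕ) : ℂ) ≠ 0 := by exact_mod_cast n.succ_ne_zero
    simp only [liTwoCoeff, Finset.sum_range_succ]
    field_simp
    ring

/-! ### The change of variable, and the differential equations on the lens. -/

/-- The region on which both `v` and `(1 - v) / (1 + v)` lie in the unit disc. -/
def lens : Set ℂ := {v | ‖v‖ < 1 ∧ 0 < v.re}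

/-- The involution `v ↦ (1 - v) / (1 + v)`. -/
noncomputable def cayley (v : ℂ) : ℂ := (1 - v) / (1 + v)

lemma isOpen_lens : IsOpen lens :=
  (isOpen_lt continuous_norm continuous_const).inter
    (isOpen_lt continuous_const Complex.continuous_re)

lemma convex_lens : Convex ℝ lens := by
  have h1 : Convex ℝ {v : ℂ | ‖v‖ < 1} := by
    have := convex_ball (0 : ℂ) 1
    rwa [ball_zero_eq] at this
  exact h1.inter (convex_halfSpace_re_gt 0)

lemma ne_zero_of_mem_lens {v : ℂ} (hv : v ∈ lens) : v ≠ 0 := by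
  rintro rfl
  exact absurd hv.2 (by simp)

lemma one_add_ne_zero_of_mem_lens {v : ℂ} (hv : v ∈ lens) : 1 + v ≠ 0 := by
  intro h
  have := congrArg Complex.re h
  have h2 := hv.2
  simp at this
  linarith

lemma one_sub_ne_zero_of_mem_lens {v : ℂ} (hv : v ∈ lens) : 1 - v ≠ 0 := by
  intro h
  have h1 := hv.1
  rw [← sub_eq_zero.1 h] at h1
  simp at h1

lemma norm_cayley_lt_one {v : ℂ} (hv : v ∈ lens) : ‖cayley v‖ < 1 := by
  rw [cayley, norm_div, div_lt_one (norm_pos_iff.2 (one_add_ne_zero_of_mem_lens hv))]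
  rw [← sq_lt_sq₀ (norm_nonneg _) (norm_nonneg _), Complex.sq_norm, Complex.sq_norm,
    Complex.normSq_apply, Complex.normSq_apply]
  have := hv.2
  simp
  nlinarith

lemma cayley_ne_zero_of_mem_lens {v : ℂ} (hv : v ∈ lens) : cayley v ≠ 0 :=
  div_ne_zero (one_sub_ne_zero_of_mem_lens hv) (one_add_ne_zero_of_mem_lens hv)

lemma hasDerivAt_cayley {v : ℂ} (hv : 1 + v ≠ 0) :
    HasDerivAt cayley (-2 / (1 + v) ^ 2) v := by
  refine (((hasDerivAt_id v).const_sub 1).div ((hasDerivAt_id v).const_add 1) hv).congr_deriv ?_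
  simp only [id]
  congr 1
  ring

/-- The generating function with coefficients `altCoeff j`, at `x = cayley v`. -/
noncomputable def altFun (j : ℕ) (v : ℂ) : ℂ := powerSum (altCoeff j) (cayley v)

lemma altFun_zero (v : ℂ) : altFun 0 v = cayley v := powerSum_altCoeff_zero _

/-- With `x = cayley v`, one has `1 - x² = 4v / (1 + v)²` and `dx = -2 dv / (1 + v)²`, so `2 dx / (1
- x²) = -dv / v`. -/
lemma hasDerivAt_altFun (j : ℕ) {v : ℂ} (hv : v ∈ lens) :
    HasDerivAt (altFun (j + 1)) (-(altFun j v / v)) v := by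
  have h1 := one_add_ne_zero_of_mem_lens hv
  have h0 := ne_zero_of_mem_lens hv
  have hx := cayley_ne_zero_of_mem_lens hv
  have hd := (hasDerivAt_powerSum (linearlyBounded_nat_mul_altCoeff j) (fun n => rfl)
    (norm_cayley_lt_one hv) hx).comp v (hasDerivAt_cayley h1)
  refine hd.congr_deriv ?_
  have key := powerSum_nat_mul_altCoeff j (norm_cayley_lt_one hv)
  have e : 1 - cayley v ^ 2 = 4 * v / (1 + v) ^ 2 := by
    rw [cayley]; field_simp; ring
  rw [e] at key
  have key2 : powerSum (fun n => (n : ℂ) * altCoeff (j + 1) n) (cayley v)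
      = cayley v * altFun j v * (1 + v) ^ 2 / (2 * v) := by
    rw [altFun]
    field_simp at key ⊢
    linear_combination (1 / 2) * key
  rw [key2]
  field_simp

/-- The odd part of the polylogarithm, up to a factor. -/
noncomputable def liOdd (s : ℕ) (v : ℂ) : ℂ := powerSum (liCoeff s) (-v) - powerSum (liCoeff s) v

lemma hasDerivAt_powerSum_liCoeff (s : ℕ) {v : ℂ} (hv : v ∈ lens) :
    HasDerivAt (powerSum (liCoeff (s + 1))) (powerSum (liCoeff s) v / v) v :=
  hasDerivAt_powerSum (linearlyBounded_liCoeff s) (nat_mul_liCoeff s) hv.1 (ne_zero_of_mem_lens hv)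

lemma hasDerivAt_powerSum_liCoeff_neg (s : ℕ) {v : ℂ} (hv : v ∈ lens) :
    HasDerivAt (fun v => powerSum (liCoeff (s + 1)) (-v)) (powerSum (liCoeff s) (-v) / v) v := by
  have h0 := ne_zero_of_mem_lens hv
  have h := hasDerivAt_powerSum (linearlyBounded_liCoeff s) (nat_mul_liCoeff s)
    (z := -v) (by simpa using hv.1) (neg_ne_zero.2 h0)
  refine (h.comp v (hasDerivAt_neg v)).congr_deriv ?_
  field_simp

lemma hasDerivAt_liOdd (s : ℕ) {v : ℂ} (hv : v ∈ lens) :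
    HasDerivAt (liOdd (s + 1)) (liOdd s v / v) v := by
  refine ((hasDerivAt_powerSum_liCoeff_neg s hv).sub
    (hasDerivAt_powerSum_liCoeff s hv)).congr_deriv ?_
  rw [liOdd, sub_div]

lemma liOdd_zero {v : ℂ} (hv : v ∈ lens) : liOdd 0 v = -(2 * v) / ((1 - v) * (1 + v)) := by
  have h1 := one_add_ne_zero_of_mem_lens hv
  have h2 := one_sub_ne_zero_of_mem_lens hv
  rw [liOdd, powerSum_liCoeff_zero hv.1, powerSum_liCoeff_zero (by simpa using hv.1)]
  rw [sub_neg_eq_add]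
  field_simp
  ring

lemma hasDerivAt_liTwo {y : ℂ} (hy : ‖y‖ ≤ 1) (s : ℕ) {v : ℂ} (hv : v ∈ lens) :
    HasDerivAt (powerSum (liTwoCoeff (-1) y s))
      (-(powerSum (liCoeff s) (-y * v) / (1 + v))) v := by
  have h1 := one_add_ne_zero_of_mem_lens hv
  have h0 := ne_zero_of_mem_lens hv
  have hx : ‖(-1 : ℂ)‖ ≤ 1 := by simp
  refine (hasDerivAt_powerSum (linearlyBounded_nat_mul_liTwoCoeff hx hy s) (fun n => rfl)
    hv.1 h0).congr_deriv ?_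
  have key := powerSum_nat_mul_liTwoCoeff hx hy s hv.1
  rw [show -1 * y * v = -y * v by ring] at key
  generalize powerSum (liCoeff s) (-y * v) = w at key ⊢
  field_simp
  linear_combination key

/-- The part of depth at most two in the evaluation. -/
noncomputable def liDepthTwo (m : ℕ) (v : ℂ) : ℂ :=
  powerSum (liCoeff (m + 2)) v - powerSum (liCoeff (m + 2)) (-v)
    + 2 * powerSum (liTwoCoeff (-1) (-1) (m + 1)) v - 2 * powerSum (liTwoCoeff (-1) 1 (m + 1)) v

/-- The partial fraction `cayley v / v = 1/v - 2/(1 + v)`: the first kernel raises the weight of the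
single polylogarithms, the second produces the double ones. -/
lemma hasDerivAt_liDepthTwo (m : ℕ) {v : ℂ} (hv : v ∈ lens) :
    HasDerivAt (liDepthTwo m) (-(liOdd (m + 1) v * cayley v / v)) v := by
  have h1 := one_add_ne_zero_of_mem_lens hv
  have h0 := ne_zero_of_mem_lens hv
  refine ((((hasDerivAt_powerSum_liCoeff (m + 1) hv).sub
    (hasDerivAt_powerSum_liCoeff_neg (m + 1) hv)).add
    ((hasDerivAt_liTwo (y := -1) (by simp) (m + 1) hv).const_mul 2)).sub
    ((hasDerivAt_liTwo (y := 1) (by simp) (m + 1) hv).const_mul 2)).congr_deriv ?_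
  rw [liOdd, cayley, neg_neg, one_mul, neg_one_mul]
  field_simp
  ring

/-- The generating function of the multiple `S` values at `x = cayley v`. -/
noncomputable def sFun (m : ℕ) (v : ℂ) : ℂ :=
  powerSum (fun n => altCoeff (m + 1) n / n) (cayley v)

lemma nat_mul_altCoeff_div (m n : ℕ) : (n : ℂ) * (altCoeff (m + 1) n / n) = altCoeff (m + 1) n := by
  rcases Nat.eq_zero_or_pos n with rfl | hn
  · simp [altCoeff_zero]
  · have : (n : ℂ) ≠ 0 := by exact_mod_cast hn.ne'
    field_simp

/-- The logarithmic form `dx / x` equals `-2 dv / ((1 - v)(1 + v))`, which is `liOdd 0 v dv / v`. -/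
lemma hasDerivAt_sFun (m : ℕ) {v : ℂ} (hv : v ∈ lens) :
    HasDerivAt (sFun m) (liOdd 0 v * altFun (m + 1) v / v) v := by
  have h1 := one_add_ne_zero_of_mem_lens hv
  have h2 := one_sub_ne_zero_of_mem_lens hv
  have h0 := ne_zero_of_mem_lens hv
  have hd := (hasDerivAt_powerSum (linearlyBounded_altCoeff (m + 1)) (nat_mul_altCoeff_div m)
    (norm_cayley_lt_one hv) (cayley_ne_zero_of_mem_lens hv)).comp v (hasDerivAt_cayley h1)
  refine hd.congr_deriv ?_
  rw [liOdd_zero hv, altFun]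
  generalize powerSum (altCoeff (m + 1)) (cayley v) = w
  rw [cayley]
  field_simp

/-- The lens is connected, so the difference is constant; the constant is read off from limits along
any filter in the lens, in particular one tending to a boundary point. -/
lemma eq_of_hasDerivAt_eq {f g f' : ℂ → ℂ} (hf : ∀ v ∈ lens, HasDerivAt f (f' v) v)
    (hg : ∀ v ∈ lens, HasDerivAt g (f' v) v) {ι : Type*} {F : Filter ι} [F.NeBot] {w : ι → ℂ}
    {a b : ℂ} (hw : ∀ᶠ t in F, w t ∈ lens) (hfa : Tendsto (fun t => f (w t)) F (𝓝 a))
    (hgb : Tendsto (fun t => g (w t)) F (𝓝 b)) {v : ℂ} (hv : v ∈ lens) :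
    f v - g v = a - b := by
  have hd : ∀ v ∈ lens, HasDerivAt (fun v => f v - g v) 0 v := fun v hv =>
    ((hf v hv).sub (hg v hv)).congr_deriv (sub_self _)
  have hc : ∀ u ∈ lens, f v - g v = f u - g u := fun u hu =>
    isOpen_lens.is_const_of_deriv_eq_zero convex_lens.isPreconnected
      (fun x hx => (hd x hx).differentiableAt.differentiableWithinAt)
      (fun x hx => (hd x hx).deriv) hv hu
  exact tendsto_nhds_unique
    (tendsto_const_nhds.congr' (hw.mono fun t ht => hc _ ht)) (hfa.sub hgb)

/-- The sum over products of weight `m` in the evaluation. -/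
noncomputable def productSum (m : ℕ) (v : ℂ) : ℂ :=
  ∑ r ∈ range (m + 1), liOdd (r + 1) v * altFun (m + 1 - r) v

lemma hasDerivAt_productSum (m : ℕ) {v : ℂ} (hv : v ∈ lens) :
    HasDerivAt (productSum m)
      (liOdd 0 v * altFun (m + 1) v / v - liOdd (m + 1) v * cayley v / v) v := by
  have h : ∀ r ∈ range (m + 1), HasDerivAt (fun v => liOdd (r + 1) v * altFun (m + 1 - r) v)
      (liOdd r v * altFun (m + 1 - r) v / v
        - liOdd (r + 1) v * altFun (m + 1 - (r + 1)) v / v) v := by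
    intro r hr
    obtain ⟨k, hk⟩ : ∃ k, m + 1 - r = k + 1 := ⟨m - r, by have := Finset.mem_range.1 hr; omega⟩
    rw [show m + 1 - (r + 1) = k by omega, hk]
    refine ((hasDerivAt_liOdd r hv).mul (hasDerivAt_altFun k hv)).congr_deriv ?_
    ring
  refine (HasDerivAt.fun_sum h).congr_deriv ?_
  -- Integration by parts telescopes: only `r = 0` and `r = m + 1` survive, the latter with `altFun
  -- 0 = cayley`.
  rw [Finset.sum_range_sub' (fun r => liOdd r v * altFun (m + 1 - r) v / v)]
  simp [altFun_zero]

lemma hasDerivAt_sFun_sub_productSum (m : ℕ) {v : ℂ} (hv : v ∈ lens) :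
    HasDerivAt (fun v => sFun m v - productSum m v + liDepthTwo m v) 0 v := by
  refine (((hasDerivAt_sFun m hv).sub (hasDerivAt_productSum m hv)).add
    (hasDerivAt_liDepthTwo m hv)).congr_deriv ?_
  ring

/-! ### Convergence of the polylogarithm, beta and `S` series. -/

lemma sum_Ico_one_eq_sum_range {f : ℕ → ℂ} (h : f 0 = 0) (N : ℕ) :
    ∑ n ∈ Ico 1 N, f n = ∑ n ∈ range N, f n := by
  rcases Nat.eq_zero_or_pos N with rfl | hN
  · simp
  · rw [Finset.range_eq_Ico, Finset.sum_eq_sum_Ico_succ_bot hN, h, zero_add]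

lemma sum_Ico_pow_div (s N : ℕ) (x : ℂ) :
    ∑ n ∈ Ico 1 N, x ^ n / (n : ℂ) ^ s = ∑ n ∈ range N, liCoeff s n * x ^ n := by
  rw [← sum_Ico_one_eq_sum_range (by simp [liCoeff])]
  refine Finset.sum_congr rfl fun n hn => ?_
  have : n ≠ 0 := by have := (Finset.mem_Ico.1 hn).1; omega
  rw [liCoeff, if_neg this]
  ring

lemma nestedSum_liTerms_single (s N : ℕ) (x : ℂ) :
    nestedSum (liTerms [(s, x)]) N = ∑ n ∈ range N, liCoeff s n * x ^ n := by
  simp only [liTerms, List.map, nestedSum, mul_one]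
  exact sum_Ico_pow_div s N x

lemma nestedSum_liTerms_pair (s N : ℕ) (x y : ℂ) :
    nestedSum (liTerms [(1, x), (s, y)]) N = ∑ n ∈ range N, liTwoCoeff x y s n := by
  simp only [liTerms, List.map, nestedSum, mul_one]
  rw [← sum_Ico_one_eq_sum_range (by simp [liTwoCoeff])]
  refine Finset.sum_congr rfl fun n _ => ?_
  rw [sum_Ico_pow_div, liTwoCoeff, pow_one]

/-- Dirichlet's test: for `x ≠ 1` on the circle the geometric sums are bounded by `2 / ‖x - 1‖`. -/
lemma exists_tendsto_li {s : ℕ} (hs : 1 ≤ s) {x : ℂ} (hx : ‖x‖ = 1) (hx1 : x ≠ 1) :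
    ∃ L, Tendsto (fun N => ∑ n ∈ range N, liCoeff s n * x ^ n) atTop (𝓝 L) := by
  have hanti : Antitone fun n : ℕ => 1 / ((n : ℝ) + 1) ^ s := by
    intro a b hab
    have : (a : ℝ) ≤ b := by exact_mod_cast hab
    exact one_div_le_one_div_of_le (by positivity) (by gcongr)
  have h0 : Tendsto (fun n : ℕ => 1 / ((n : ℝ) + 1) ^ s) atTop (𝓝 0) := by
    have h := (tendsto_one_div_add_atTop_nhds_zero_nat (𝕜 := ℝ)).pow s
    rw [zero_pow (by omega)] at h
    simpa [div_pow] using h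
  have hb : ∀ n, ‖∑ i ∈ range n, x ^ (i + 1)‖ ≤ 2 / ‖x - 1‖ := by
    intro n
    have e : ∑ i ∈ range n, x ^ (i + 1) = x * ((x ^ n - 1) / (x - 1)) := by
      rw [← geom_sum_eq hx1, Finset.mul_sum]
      exact Finset.sum_congr rfl fun i _ => pow_succ' x i
    rw [e, norm_mul, hx, one_mul, norm_div]
    refine div_le_div_of_nonneg_right ?_ (norm_nonneg _)
    refine (norm_sub_le _ _).trans ?_
    rw [norm_pow, hx, one_pow, norm_one]
    norm_num
  obtain ⟨L, hL⟩ := cauchySeq_tendsto_of_complete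
    (hanti.cauchySeq_series_mul_of_tendsto_zero_of_bounded h0 hb)
  refine ⟨L, (tendsto_add_atTop_iff_nat 1).1 (hL.congr fun N => ?_)⟩
  rw [Finset.sum_range_succ']
  simp [liCoeff]

lemma norm_liCoeff_mul_pow_le {s : ℕ} (hs : 2 ≤ s) {y : ℂ} (hy : ‖y‖ ≤ 1) (n : ℕ) :
    ‖liCoeff s n * y ^ n‖ ≤ 1 / (n : ℝ) ^ 2 := by
  rcases Nat.eq_zero_or_pos n with rfl | hn
  · simp [liCoeff]
  have h1 : (1 : ℝ) ≤ n := by exact_mod_cast hn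
  rw [norm_mul, norm_pow, liCoeff, if_neg hn.ne', norm_div, norm_one, norm_pow,
    Complex.norm_natCast]
  refine (mul_le_of_le_one_right (by positivity) (pow_le_one₀ (norm_nonneg _) hy)).trans ?_
  exact one_div_le_one_div_of_le (by positivity) (pow_le_pow_right₀ h1 hs)

lemma summable_norm_liCoeff_mul_pow {s : ℕ} (hs : 2 ≤ s) {y : ℂ} (hy : ‖y‖ ≤ 1) :
    Summable fun n => ‖liCoeff s n * y ^ n‖ :=
  Summable.of_nonneg_of_le (fun _ => norm_nonneg _) (norm_liCoeff_mul_pow_le hs hy)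
    (Real.summable_one_div_nat_pow.2 one_lt_two)

lemma exists_tendsto_li_of_two_le {s : ℕ} (hs : 2 ≤ s) {y : ℂ} (hy : ‖y‖ ≤ 1) :
    ∃ L, Tendsto (fun N => ∑ n ∈ range N, liCoeff s n * y ^ n) atTop (𝓝 L) :=
  ⟨_, (summable_norm_liCoeff_mul_pow hs hy).of_norm.hasSum.tendsto_sum_nat⟩

/-- Exchanging the order of summation leaves a product of convergent sums and, for `s ≥ 2`, an
absolutely convergent series with bounded inner factors; this handles the conditionally convergent
outer sum. -/
lemma sum_liTwoCoeff (x y : ℂ) (s N : ℕ) :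
    ∑ n ∈ range N, liTwoCoeff x y s n =
      (∑ n ∈ range N, liCoeff 1 n * x ^ n) * (∑ n ∈ range N, liCoeff s n * y ^ n)
        - ∑ k ∈ range N, liCoeff s k * y ^ k * ∑ n ∈ range (k + 1), liCoeff 1 n * x ^ n := by
  induction N with
  | zero => simp
  | succ N ih =>
    have e : liTwoCoeff x y s N
        = liCoeff 1 N * x ^ N * ∑ k ∈ range N, liCoeff s k * y ^ k := by
      rw [liTwoCoeff, liCoeff]
      split_ifs with h
      · simp [h]
      · rw [pow_one]; ring
    simp only [Finset.sum_range_succ] at ih ⊢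
    rw [ih, e]
    ring

lemma exists_tendsto_liTwo {s : ℕ} (hs : 2 ≤ s) {x y : ℂ} (hx : ‖x‖ = 1) (hx1 : x ≠ 1)
    (hy : ‖y‖ ≤ 1) :
    ∃ L, Tendsto (fun N => ∑ n ∈ range N, liTwoCoeff x y s n) atTop (𝓝 L) := by
  obtain ⟨L, hL⟩ := exists_tendsto_li le_rfl hx hx1
  obtain ⟨L', hL'⟩ := exists_tendsto_li_of_two_le hs hy
  obtain ⟨B, hB⟩ := (Metric.isBounded_range_of_tendsto _ hL).exists_norm_le
  have hB' : ∀ N, ‖∑ n ∈ range N, liCoeff 1 n * x ^ n‖ ≤ B := fun N => hB _ ⟨N, rfl⟩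
  have hsum : Summable fun k =>
      liCoeff s k * y ^ k * ∑ n ∈ range (k + 1), liCoeff 1 n * x ^ n := by
    refine Summable.of_norm_bounded ((summable_norm_liCoeff_mul_pow hs hy).mul_right B) fun k => ?_
    rw [norm_mul]
    exact mul_le_mul_of_nonneg_left (hB' _) (norm_nonneg _)
  exact ⟨_, ((hL.mul hL').sub hsum.hasSum.tendsto_sum_nat).congr fun N =>
    (sum_liTwoCoeff x y s N).symm⟩

lemma multiLiConverges_single {s : ℕ} (hs : 1 ≤ s) {x : ℂ} (hx : ‖x‖ = 1) (hx1 : x ≠ 1) :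
    MultiLiConverges [(s, x)] := by
  obtain ⟨L, hL⟩ := exists_tendsto_li hs hx hx1
  exact ⟨L, hL.congr fun N => (nestedSum_liTerms_single s N x).symm⟩

lemma multiLiConverges_single_of_two_le {s : ℕ} (hs : 2 ≤ s) {x : ℂ} (hx : ‖x‖ ≤ 1) :
    MultiLiConverges [(s, x)] := by
  obtain ⟨L, hL⟩ := exists_tendsto_li_of_two_le hs hx
  exact ⟨L, hL.congr fun N => (nestedSum_liTerms_single s N x).symm⟩

lemma multiLiConverges_pair {s : ℕ} (hs : 2 ≤ s) {x y : ℂ} (hx : ‖x‖ = 1) (hx1 : x ≠ 1)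
    (hy : ‖y‖ ≤ 1) : MultiLiConverges [(1, x), (s, y)] := by
  obtain ⟨L, hL⟩ := exists_tendsto_liTwo hs hx hx1 hy
  exact ⟨L, hL.congr fun N => (nestedSum_liTerms_pair s N x y).symm⟩

lemma tendsto_multiLi_single {s : ℕ} {x : ℂ} (h : MultiLiConverges [(s, x)]) :
    Tendsto (fun N => ∑ n ∈ range N, liCoeff s n * x ^ n) atTop (𝓝 (multiLi [(s, x)])) :=
  (tendsto_nhds_limUnder h).congr fun N => nestedSum_liTerms_single s N x

lemma tendsto_multiLi_pair {s : ℕ} {x y : ℂ} (h : MultiLiConverges [(1, x), (s, y)]) :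
    Tendsto (fun N => ∑ n ∈ range N, liTwoCoeff x y s n) atTop
      (𝓝 (multiLi [(1, x), (s, y)])) :=
  (tendsto_nhds_limUnder h).congr fun N => nestedSum_liTerms_pair s N x y

lemma dirichletBetaConverges {s : ℕ} (hs : 1 ≤ s) : DirichletBetaConverges s := by
  have hanti : Antitone fun n : ℕ => 1 / (2 * (n : ℝ) + 1) ^ s := by
    intro a b hab
    have : (a : ℝ) ≤ b := by exact_mod_cast hab
    exact one_div_le_one_div_of_le (by positivity) (by gcongr)
  have h0 : Tendsto (fun n : ℕ => 1 / (2 * (n : ℝ) + 1) ^ s) atTop (𝓝 0) := by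
    have h1 : Tendsto (fun n : ℕ => 2 * (n : ℝ) + 1) atTop atTop :=
      tendsto_atTop_add_const_right _ _
        (tendsto_natCast_atTop_atTop.const_mul_atTop zero_lt_two)
    simpa [Function.comp_def] using
      tendsto_inv_atTop_zero.comp ((tendsto_pow_atTop (by omega : s ≠ 0)).comp h1)
  obtain ⟨L, hL⟩ := hanti.tendsto_alternating_series_of_tendsto_zero h0
  refine ⟨L, hL.congr fun N => ?_⟩
  simp only [betaPartial, mul_one_div]

lemma I_ne_one : Complex.I ≠ 1 := fun h => by simpa using congrArg Complex.re h

lemma neg_I_ne_one : -Complex.I ≠ 1 := fun h => by simpa using congrArg Complex.re h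

lemma two_I_mul_dirichletBeta {s : ℕ} (hs : 1 ≤ s) :
    2 * Complex.I * (dirichletBeta s : ℂ)
      = multiLi [(s, Complex.I)] - multiLi [(s, -Complex.I)] := by
  have h1 := tendsto_multiLi_single (multiLiConverges_single hs (by simp) I_ne_one)
  have h2 := tendsto_multiLi_single (multiLiConverges_single hs (by simp) neg_I_ne_one)
  have h3 : Tendsto (betaPartial s) atTop (𝓝 (dirichletBeta s)) :=
    tendsto_nhds_limUnder (dirichletBetaConverges hs)
  have h4 : Tendsto (fun N => 2 * Complex.I * (betaPartial s N : ℂ)) atTop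
      (𝓝 (2 * Complex.I * (dirichletBeta s : ℂ))) :=
    ((Complex.continuous_ofReal.tendsto _).comp h3).const_mul _
  -- Comparison along truncations at `2N`: in `i^n - (-i)^n` the even terms cancel and `n = 2k + 1`
  -- gives `2i (-1)^k`.
  refine tendsto_nhds_unique h4 (((h1.sub h2).comp
    (tendsto_id.const_mul_atTop' (zero_lt_two : 0 < 2))).congr fun N => ?_)
  simp only [Function.comp, id]
  induction N with
  | zero => simp [betaPartial]
  | succ N ih =>
    rw [show 2 * (N + 1) = 2 * N + 1 + 1 by ring, Finset.sum_range_succ, Finset.sum_range_succ,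
      Finset.sum_range_succ _ (2 * N + 1), Finset.sum_range_succ _ (2 * N)]
    have e : betaPartial s (N + 1) = betaPartial s N + (-1) ^ N / (2 * (N : ℝ) + 1) ^ s := by
      rw [betaPartial, Finset.sum_range_succ, betaPartial]
    rw [e]
    push_cast
    rw [mul_add, ← ih]
    have e1 : (-Complex.I) ^ (2 * N) = (-1) ^ N := by rw [pow_mul]; simp
    have e2 : Complex.I ^ (2 * N) = (-1) ^ N := by rw [pow_mul]; simp
    rw [pow_succ, pow_succ, e1, e2, liCoeff, liCoeff, if_neg (by omega : 2 * N + 1 ≠ 0)]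
    push_cast
    ring

lemma exists_tendsto_altCoeff_div (m : ℕ) {x : ℂ} (hx : ‖x‖ ≤ 1) :
    ∃ L, Tendsto (fun N => ∑ n ∈ range N, altCoeff (m + 1) n / n * x ^ n) atTop (𝓝 L) := by
  obtain ⟨C, hC, h⟩ := exists_norm_nat_mul_altCoeff_le m
  have hs : Summable fun n => altCoeff (m + 1) n / n * x ^ n := by
    refine Summable.of_norm_bounded
      ((Real.summable_one_div_nat_rpow.2 (by norm_num : (1 : ℝ) < 3 / 2)).mul_left C) fun n => ?_
    rcases Nat.eq_zero_or_pos n with rfl | hn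
    · simp
    have hn0 : (0 : ℝ) < n := by exact_mod_cast hn
    have e : ‖altCoeff (m + 1) n / n‖ = ‖(n : ℂ) * altCoeff (m + 1) n‖ / (n : ℝ) ^ 2 := by
      rw [norm_div, norm_mul, Complex.norm_natCast]
      field_simp
    have e2 : (n : ℝ) ^ (3 / 2 : ℝ) * √(n : ℝ) = (n : ℝ) ^ 2 := by
      rw [Real.sqrt_eq_rpow, ← Real.rpow_add hn0, ← Real.rpow_natCast]
      norm_num
    rw [norm_mul, norm_pow]
    refine (mul_le_of_le_one_right (norm_nonneg _) (pow_le_one₀ (norm_nonneg _) hx)).trans ?_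
    rw [e, ← e2, mul_one_div, div_le_div_iff₀ (by positivity) (by positivity)]
    calc _ ≤ C * √(n : ℝ) * (n : ℝ) ^ (3 / 2 : ℝ) := by gcongr; exact h n
      _ = _ := by ring
  exact ⟨_, hs.hasSum.tendsto_sum_nat⟩

/-! ### The `S` value as the series at `x = i`. -/

lemma nestedSum_replicate (j N : ℕ) :
    nestedSum (mixedTerms (withSParities (List.replicate j (1, 1)))) N = altHarm j N := by
  induction j generalizing N with
  | zero => simp [withSParities, mixedTerms, nestedSum, altHarm]
  | succ j ih =>
    rw [List.replicate_succ, withSParities, altHarm]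
    simp only [mixedTerms, List.map_cons, nestedSum] at ih ⊢
    refine Finset.sum_congr rfl fun n _ => ?_
    rw [ih]
    simp [pow_add]

/-- For `m` and `n` even the sign is `(-1)^(n/2) = i^n`; for both odd it is `(-1)^((n+1)/2) = i *
i^n`, the source of the prefactor `i^δ`. For unequal parities both sides vanish. -/
lemma sign_factor (m n : ℕ) :
    (((1 + ((((-1) ^ m : ℤˣ) : ℤ) : ℝ) * (-1) ^ n) *
      ((((-1 : ℤˣ) ^ ((2 * (n : ℤ) + 1 - (((-1) ^ m : ℤˣ) : ℤ)) / 4) : ℤˣ) : ℤ) : ℝ) : ℝ) : ℂ)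
    = Complex.I ^ (if Odd m then 1 else 0) * ((1 + (-1) ^ (m + n)) * Complex.I ^ n) := by
  rcases Nat.even_or_odd m with hm | hm
  · rw [if_neg (Nat.not_odd_iff_even.2 hm), pow_add, hm.neg_one_pow, hm.neg_one_pow]
    rcases Nat.even_or_odd' n with ⟨k, rfl | rfl⟩
    · have : (2 * ((2 * k : ℕ) : ℤ) + 1 - ((1 : ℤˣ) : ℤ)) / 4 = (k : ℤ) := by push_cast; omega
      rw [this, zpow_natCast, pow_mul Complex.I]
      simp
    · simp [pow_succ]
  · rw [if_pos hm, pow_add, hm.neg_one_pow, hm.neg_one_pow]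
    rcases Nat.even_or_odd' n with ⟨k, rfl | rfl⟩
    · simp
    · have : (2 * ((2 * k + 1 : ℕ) : ℤ) + 1 - ((-1 : ℤˣ) : ℤ)) / 4 = ((k + 1 : ℕ) : ℤ) := by
        push_cast; omega
      rw [this, zpow_natCast, pow_succ Complex.I (2 * k), pow_mul Complex.I]
      simp [pow_succ]
      linear_combination (-2 * (-1) ^ k : ℂ) * Complex.I_mul_I

lemma nestedSum_argsBarTwoOnes {m : ℕ} (hm : 1 ≤ m) (N : ℕ) :
    ((nestedSum (mixedTerms (withSParities (argsBarTwoOnes m))) N : ℝ) : ℂ)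
      = Complex.I ^ (if Odd m then 1 else 0)
        * ∑ n ∈ range N, altCoeff (m + 1) n / n * Complex.I ^ n := by
  have e : argsBarTwoOnes m = (-1, 2) :: List.replicate m (1, 1) := by
    rw [argsBarTwoOnes]
    congr 1
    obtain ⟨k, rfl⟩ := Nat.exists_eq_succ_of_ne_zero (by omega : m ≠ 0)
    rw [Nat.succ_sub_one, ← List.replicate_succ']
  have ih := fun n => nestedSum_replicate m n
  rw [e, withSParities]
  simp only [mixedTerms, List.map_cons, nestedSum, List.length_replicate] at ih ⊢
  rw [← sum_Ico_one_eq_sum_range (by simp), Complex.ofReal_sum, Finset.mul_sum]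
  refine Finset.sum_congr rfl fun n _ => ?_
  rw [ih, Complex.ofReal_mul, Complex.ofReal_div, sign_factor, altCoeff]
  push_cast
  ring

lemma multiSConverges_argsBarTwoOnes {m : ℕ} (hm : 1 ≤ m) :
    MultiSConverges (argsBarTwoOnes m) := by
  obtain ⟨L, hL⟩ := exists_tendsto_altCoeff_div m (x := Complex.I) (by simp)
  have h := (hL.const_mul (Complex.I ^ (if Odd m then 1 else 0))).congr
    fun N => (nestedSum_argsBarTwoOnes hm N).symm
  refine ⟨_, ((Complex.continuous_re.tendsto _).comp h).congr fun N => ?_⟩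
  simp only [Function.comp, Complex.ofReal_re]

lemma multiS_eq_mul_of_tendsto {m : ℕ} (hm : 1 ≤ m) {L : ℂ}
    (hL : Tendsto (fun N => ∑ n ∈ range N, altCoeff (m + 1) n / n * Complex.I ^ n) atTop (𝓝 L)) :
    (multiS (argsBarTwoOnes m) : ℂ) = Complex.I ^ (if Odd m then 1 else 0) * L := by
  have h1 : Tendsto (nestedSum (mixedTerms (withSParities (argsBarTwoOnes m)))) atTop
      (𝓝 (multiS (argsBarTwoOnes m))) :=
    tendsto_nhds_limUnder (multiSConverges_argsBarTwoOnes hm)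
  exact tendsto_nhds_unique ((Complex.continuous_ofReal.tendsto _).comp h1)
    ((hL.const_mul _).congr fun N => (nestedSum_argsBarTwoOnes hm N).symm)

/-! ### Paths to the boundary points `1` and `-i`. -/

/-- The segment from `1` to `0`, as a path approaching `1`. -/
noncomputable def pathOne (t : ℝ) : ℂ := ((1 - t : ℝ) : ℂ)

/-- The path approaching `-i` along the bisector of the lens. -/
noncomputable def pathNegI (t : ℝ) : ℂ := ⟨t, t - 1⟩

lemma eventually_small : ∀ᶠ t : ℝ in 𝓝[>] 0, 0 < t ∧ t < 1 / 2 :=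
  Ioo_mem_nhdsGT (by norm_num)

lemma tendsto_pathOne : Tendsto pathOne (𝓝[>] 0) (𝓝 1) := by
  have : Continuous pathOne := by unfold pathOne; fun_prop
  exact (this.tendsto' 0 1 (by simp [pathOne])).mono_left nhdsWithin_le_nhds

lemma norm_pathOne {t : ℝ} (ht : 0 < t ∧ t < 1 / 2) : ‖pathOne t‖ = 1 - t := by
  rw [pathOne, Complex.norm_real, Real.norm_of_nonneg (by linarith)]

lemma norm_one_sub_pathOne {t : ℝ} (ht : 0 < t ∧ t < 1 / 2) : ‖1 - pathOne t‖ = t := by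
  have : 1 - pathOne t = (t : ℂ) := by simp [pathOne]
  rw [this, Complex.norm_real, Real.norm_of_nonneg ht.1.le]

lemma pathOne_mem_lens : ∀ᶠ t in 𝓝[>] 0, pathOne t ∈ lens := by
  filter_upwards [eventually_small] with t ht
  refine ⟨by rw [norm_pathOne ht]; linarith, ?_⟩
  simp only [pathOne, Complex.ofReal_re]
  linarith

lemma tendsto_powerSum_pathOne {a : ℕ → ℂ} {L : ℂ}
    (ha : Tendsto (fun N => ∑ n ∈ range N, a n * 1 ^ n) atTop (𝓝 L)) :
    Tendsto (fun t => powerSum a (pathOne t)) (𝓝[>] 0) (𝓝 L) := by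
  refine tendsto_powerSum 2 (by simp) ha tendsto_pathOne ?_
  filter_upwards [eventually_small] with t ht
  rw [norm_pathOne ht, norm_one_sub_pathOne ht]
  exact ⟨by linarith, by linarith⟩

lemma tendsto_powerSum_neg_pathOne {a : ℕ → ℂ} {L : ℂ}
    (ha : Tendsto (fun N => ∑ n ∈ range N, a n * (-1) ^ n) atTop (𝓝 L)) :
    Tendsto (fun t => powerSum a (-pathOne t)) (𝓝[>] 0) (𝓝 L) := by
  refine tendsto_powerSum 2 (by simp) ha tendsto_pathOne.neg ?_
  filter_upwards [eventually_small] with t ht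
  have e : -1 - -pathOne t = -(1 - pathOne t) := by ring
  rw [e, norm_neg, norm_neg, norm_pathOne ht, norm_one_sub_pathOne ht]
  exact ⟨by linarith, by linarith⟩

lemma tendsto_pathNegI : Tendsto pathNegI (𝓝[>] 0) (𝓝 (-Complex.I)) := by
  have e : pathNegI = fun t : ℝ => (t : ℂ) + ((t - 1 : ℝ) : ℂ) * Complex.I := by
    funext t
    rw [pathNegI, Complex.mk_eq_add_mul_I]
  have : Continuous pathNegI := by rw [e]; fun_prop
  exact (this.tendsto' 0 _ (by simp [e])).mono_left nhdsWithin_le_nhds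

/-- The constant `4` comes from `‖w‖ ≤ 1 - t/2` and `‖ζ - w‖ ≤ √2 t < 2t`. -/
lemma stolz_of_sq_le {w ζ : ℂ} {t : ℝ} (ht : 0 < t) (h1 : ‖w‖ ^ 2 ≤ 1 - t)
    (h2 : ‖ζ - w‖ ^ 2 ≤ 2 * t ^ 2) : ‖w‖ < 1 ∧ ‖ζ - w‖ < 4 * (1 - ‖w‖) := by
  have hw := norm_nonneg w
  have hz := norm_nonneg (ζ - w)
  have h3 : ‖w‖ ≤ 1 - t / 2 := by
    refine (sq_le_sq₀ hw (by nlinarith)).1 ?_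
    nlinarith [sq_nonneg t]
  refine ⟨by linarith, ?_⟩
  have h4 : ‖ζ - w‖ < 2 * t := by
    refine (sq_lt_sq₀ hz (by linarith)).1 ?_
    nlinarith [pow_pos ht 2]
  linarith

lemma norm_sq_pathNegI_le {t : ℝ} (ht : 0 < t ∧ t < 1 / 2) : ‖pathNegI t‖ ^ 2 ≤ 1 - t := by
  rw [Complex.sq_norm, Complex.normSq_apply]
  simp only [pathNegI]
  nlinarith [ht.1, ht.2]

lemma norm_sq_neg_I_sub_pathNegI (t : ℝ) : ‖-Complex.I - pathNegI t‖ ^ 2 = 2 * t ^ 2 := by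
  rw [Complex.sq_norm, Complex.normSq_apply]
  simp [pathNegI]
  ring

lemma pathNegI_mem_lens : ∀ᶠ t in 𝓝[>] 0, pathNegI t ∈ lens := by
  filter_upwards [eventually_small] with t ht
  exact ⟨(stolz_of_sq_le ht.1 (norm_sq_pathNegI_le ht) (norm_sq_neg_I_sub_pathNegI t).le).1, ht.1⟩

lemma tendsto_powerSum_pathNegI {a : ℕ → ℂ} {L : ℂ}
    (ha : Tendsto (fun N => ∑ n ∈ range N, a n * (-Complex.I) ^ n) atTop (𝓝 L)) :
    Tendsto (fun t => powerSum a (pathNegI t)) (𝓝[>] 0) (𝓝 L) := by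
  refine tendsto_powerSum 4 (by simp) ha tendsto_pathNegI ?_
  filter_upwards [eventually_small] with t ht
  exact stolz_of_sq_le ht.1 (norm_sq_pathNegI_le ht) (norm_sq_neg_I_sub_pathNegI t).le

lemma tendsto_powerSum_neg_pathNegI {a : ℕ → ℂ} {L : ℂ}
    (ha : Tendsto (fun N => ∑ n ∈ range N, a n * Complex.I ^ n) atTop (𝓝 L)) :
    Tendsto (fun t => powerSum a (-pathNegI t)) (𝓝[>] 0) (𝓝 L) := by
  refine tendsto_powerSum 4 (by simp) ha (by simpa using tendsto_pathNegI.neg) ?_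
  filter_upwards [eventually_small] with t ht
  have e : Complex.I - -pathNegI t = -(-Complex.I - pathNegI t) := by ring
  refine stolz_of_sq_le ht.1 (by rw [norm_neg]; exact norm_sq_pathNegI_le ht) ?_
  rw [e, norm_neg, norm_sq_neg_I_sub_pathNegI]

lemma one_sub_I_mul_I : (1 - Complex.I) * Complex.I = 1 + Complex.I := by
  linear_combination -Complex.I_mul_I

lemma one_sub_I_ne_zero : 1 - Complex.I ≠ 0 := fun h => by simpa using congrArg Complex.re h

lemma tendsto_cayley_pathNegI :
    Tendsto (fun t => cayley (pathNegI t)) (𝓝[>] 0) (𝓝 Complex.I) := by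
  have h : cayley (-Complex.I) = Complex.I := by
    rw [cayley, sub_neg_eq_add, ← sub_eq_add_neg, ← one_sub_I_mul_I,
      mul_div_cancel_left₀ _ one_sub_I_ne_zero]
  have hc := (hasDerivAt_cayley (v := -Complex.I)
    (by rw [← sub_eq_add_neg]; exact one_sub_I_ne_zero)).continuousAt.tendsto
  rw [h] at hc
  exact hc.comp tendsto_pathNegI

/-- The involution exchanges the circular and straight sides of the lens, so the path must avoid
tangency to both; the bisector at `-i` does, and its image is therefore again a Stolz approach, to
`i`. -/
lemma tendsto_powerSum_cayley_pathNegI {a : ℕ → ℂ} {L : ℂ}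
    (ha : Tendsto (fun N => ∑ n ∈ range N, a n * Complex.I ^ n) atTop (𝓝 L)) :
    Tendsto (fun t => powerSum a (cayley (pathNegI t))) (𝓝[>] 0) (𝓝 L) := by
  refine tendsto_powerSum 4 (by simp) ha tendsto_cayley_pathNegI ?_
  filter_upwards [eventually_small] with t ht
  have ht0 := ht.1
  have hd : Complex.normSq (1 + pathNegI t) = 2 * (1 + t ^ 2) := by
    rw [Complex.normSq_apply]; simp [pathNegI]; ring
  have hn : Complex.normSq (1 - pathNegI t) = 2 * (1 - t) ^ 2 := by
    rw [Complex.normSq_apply]; simp [pathNegI]; ring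
  have h0 : 1 + pathNegI t ≠ 0 := by
    rw [← Complex.normSq_pos, hd]; positivity
  refine stolz_of_sq_le (t := t) ht0 ?_ ?_
  · rw [cayley, Complex.sq_norm, Complex.normSq_div, hd, hn, div_le_iff₀ (by positivity)]
    nlinarith [mul_pos ht0 ht0, mul_pos ht0 (mul_pos ht0 ht0)]
  · have e : Complex.I - cayley (pathNegI t)
        = (Complex.I * (1 + pathNegI t) - (1 - pathNegI t)) / (1 + pathNegI t) := by
      rw [cayley]; field_simp
    have hn' : Complex.normSq (Complex.I * (1 + pathNegI t) - (1 - pathNegI t))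
        = 4 * t ^ 2 := by
      rw [Complex.normSq_apply]; simp [pathNegI]; ring
    rw [e, Complex.sq_norm, Complex.normSq_div, hd, hn', div_le_iff₀ (by positivity)]
    nlinarith [mul_pos ht0 ht0, mul_pos (mul_pos ht0 ht0) (mul_pos ht0 ht0)]

/-! ### Closed form of the iterated integrals `altFun`. -/

/-- The expression of `altFun j` through the logarithm and polylogarithms. -/
noncomputable def logLi (j : ℕ) (ℓ L : ℂ) : ℂ :=
  ℓ ^ j / (j.factorial : ℂ) + 2 * (-1) ^ j * L
    - ∑ p ∈ range j, 2 * (-1) ^ (p + 1) * multiLi [(p + 1, -1)]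
        * (ℓ ^ (j - 1 - p) / ((j - 1 - p).factorial : ℂ))

lemma hasDerivAt_pow_div_factorial {f : ℂ → ℂ} {f' v : ℂ} (hf : HasDerivAt f f' v) (k : ℕ) :
    HasDerivAt (fun v => f v ^ (k + 1) / ((k + 1).factorial : ℂ))
      (f' * (f v ^ k / (k.factorial : ℂ))) v := by
  refine ((hf.pow (k + 1)).div_const _).congr_deriv ?_
  have h1 : (k.factorial : ℂ) ≠ 0 := by exact_mod_cast k.factorial_ne_zero
  have h2 : (k : ℂ) + 1 ≠ 0 := by exact_mod_cast k.succ_ne_zero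
  rw [Nat.factorial_succ]
  push_cast
  field_simp

lemma hasDerivAt_logLi (j : ℕ) {v : ℂ} (hv : v ∈ lens) :
    HasDerivAt (fun v => logLi (j + 1) (-Complex.log v) (powerSum (liCoeff (j + 1)) (-v)))
      (-(logLi j (-Complex.log v) (powerSum (liCoeff j) (-v)) / v)) v := by
  have h0 := ne_zero_of_mem_lens hv
  have hlog : HasDerivAt (fun v => -Complex.log v) (-v⁻¹) v :=
    (Complex.hasDerivAt_log (Or.inl hv.2)).neg
  have hsum : HasDerivAt (fun v => ∑ p ∈ range (j + 1),
      2 * (-1) ^ (p + 1) * multiLi [(p + 1, -1)]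
        * ((-Complex.log v) ^ (j + 1 - 1 - p) / ((j + 1 - 1 - p).factorial : ℂ)))
      (∑ p ∈ range j, 2 * (-1) ^ (p + 1) * multiLi [(p + 1, -1)]
        * (-v⁻¹ * ((-Complex.log v) ^ (j - 1 - p) / ((j - 1 - p).factorial : ℂ)))) v := by
    -- The summand `p = j` carries the power zero of the logarithm, so it is constant and drops out
    -- on differentiation.
    simp only [Finset.sum_range_succ _ j, Nat.add_sub_cancel, Nat.sub_self, pow_zero]
    refine HasDerivAt.add_const _ (HasDerivAt.fun_sum fun p hp => ?_)
    have hp' := Finset.mem_range.1 hp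
    obtain ⟨k, hk⟩ : ∃ k, j - p = k + 1 := ⟨j - 1 - p, by omega⟩
    rw [hk, show j - 1 - p = k by omega]
    exact (hasDerivAt_pow_div_factorial hlog k).const_mul _
  refine (((hasDerivAt_pow_div_factorial hlog j).add
    ((hasDerivAt_powerSum_liCoeff_neg j hv).const_mul (2 * (-1) ^ (j + 1)))).sub
    hsum).congr_deriv ?_
  have e : ∑ p ∈ range j, 2 * (-1) ^ (p + 1) * multiLi [(p + 1, -1)]
        * (-v⁻¹ * ((-Complex.log v) ^ (j - 1 - p) / ((j - 1 - p).factorial : ℂ)))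
      = -v⁻¹ * ∑ p ∈ range j, 2 * (-1) ^ (p + 1) * multiLi [(p + 1, -1)]
        * ((-Complex.log v) ^ (j - 1 - p) / ((j - 1 - p).factorial : ℂ)) := by
    rw [Finset.mul_sum]
    exact Finset.sum_congr rfl fun p _ => by ring
  rw [e, logLi]
  ring

lemma continuous_logLi (j : ℕ) : Continuous fun z : ℂ × ℂ => logLi j z.1 z.2 := by
  unfold logLi
  fun_prop

/-- The constants `Li_{p+1}(-1)` are chosen for this normalisation at `v = 1`: the only surviving
summand, `p = j`, cancels the polylogarithm. -/
lemma logLi_zero_multiLi (j : ℕ) : logLi (j + 1) 0 (multiLi [(j + 1, -1)]) = 0 := by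
  rw [logLi, Finset.sum_range_succ, Finset.sum_eq_zero]
  · simp
  · intro p hp
    have := Finset.mem_range.1 hp
    rw [zero_pow (by omega)]
    simp

lemma neg_one_ne_one : (-1 : ℂ) ≠ 1 := by norm_num

lemma tendsto_cayley_pathOne : Tendsto (fun t => cayley (pathOne t)) (𝓝[>] 0) (𝓝 0) := by
  have hc := (hasDerivAt_cayley (v := 1) (by norm_num)).continuousAt.tendsto
  rw [show cayley 1 = 0 by simp [cayley]] at hc
  exact hc.comp tendsto_pathOne

/-- Mere vanishing at `v = 1` is not enough: this linear rate has to beat the logarithmic divergence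
of `Li_1(v)` there. -/
lemma isBigO_altFun_pathOne (j : ℕ) :
    (fun t => altFun (j + 1) (pathOne t)) =O[𝓝[>] 0] fun t : ℝ => t := by
  have h1 := (hasDerivAt_powerSum_nat_mul (linearlyBounded_nat_mul_altCoeff j) (fun n => rfl)
    (z := 0) (by simp)).isBigO_sub
  rw [powerSum_zero (altCoeff_zero (j + 1))] at h1
  simp only [sub_zero] at h1
  refine (h1.comp_tendsto tendsto_cayley_pathOne).trans
    (Asymptotics.IsBigO.of_bound 1 ?_)
  filter_upwards [eventually_small] with t ht
  have e : 1 + pathOne t = ((2 - t : ℝ) : ℂ) := by rw [pathOne]; push_cast; ring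
  simp only [Function.comp]
  rw [cayley, norm_div, norm_one_sub_pathOne ht, e, Complex.norm_real,
    Real.norm_of_nonneg (by linarith), Real.norm_of_nonneg ht.1.le, one_mul]
  exact div_le_self ht.1.le (by linarith)

lemma tendsto_altFun_pathOne (j : ℕ) :
    Tendsto (fun t => altFun (j + 1) (pathOne t)) (𝓝[>] 0) (𝓝 0) :=
  (isBigO_altFun_pathOne j).trans_tendsto (tendsto_id.mono_left nhdsWithin_le_nhds)

lemma altFun_eq_logLi (j : ℕ) : ∀ v ∈ lens,
    altFun j v = logLi j (-Complex.log v) (powerSum (liCoeff j) (-v)) := by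
  induction j with
  | zero =>
    intro v hv
    have h1 := one_add_ne_zero_of_mem_lens hv
    rw [altFun_zero, logLi, powerSum_liCoeff_zero (by simpa using hv.1), cayley, sub_neg_eq_add]
    simp
    field_simp
    ring
  | succ j ih =>
    intro v hv
    have hlog : Tendsto (fun t => -Complex.log (pathOne t)) (𝓝[>] 0) (𝓝 0) := by
      have := ((Complex.hasDerivAt_log (z := 1) (by simp)).continuousAt.tendsto.comp
        tendsto_pathOne).neg
      simpa [Function.comp_def] using this
    have hli := tendsto_powerSum_neg_pathOne (tendsto_multiLi_single
      (multiLiConverges_single (s := j + 1) (by omega) (by simp) neg_one_ne_one))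
    have hlim := ((continuous_logLi (j + 1)).tendsto _).comp (hlog.prodMk_nhds hli)
    simp only [logLi_zero_multiLi] at hlim
    have h := eq_of_hasDerivAt_eq (f' := fun v => -(altFun j v / v))
      (f := altFun (j + 1))
      (g := fun v => logLi (j + 1) (-Complex.log v) (powerSum (liCoeff (j + 1)) (-v)))
      (fun v hv => hasDerivAt_altFun j hv) (fun v hv => by rw [ih v hv]; exact hasDerivAt_logLi j hv) pathOne_mem_lens
      (tendsto_altFun_pathOne j) hlim hv
    rwa [sub_self, sub_eq_zero] at h

lemma powerSum_liCoeff_one {z : ℂ} (hz : ‖z‖ < 1) :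
    powerSum (liCoeff 1) z = -Complex.log (1 - z) := by
  rw [← (Complex.hasSum_taylorSeries_neg_log hz).tsum_eq]
  refine tsum_congr fun n => ?_
  rw [liCoeff]
  split_ifs with h
  · simp [h]
  · rw [pow_one]; ring

lemma tendsto_li_one_mul_altFun (j : ℕ) :
    Tendsto (fun t => powerSum (liCoeff 1) (pathOne t) * altFun (j + 1) (pathOne t))
      (𝓝[>] 0) (𝓝 0) := by
  have hO : (fun t => powerSum (liCoeff 1) (pathOne t)) =O[𝓝[>] 0] fun t : ℝ => Real.log t := by
    refine Asymptotics.IsBigO.of_bound 1 ?_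
    filter_upwards [eventually_small] with t ht
    have e : 1 - pathOne t = (t : ℂ) := by simp [pathOne]
    rw [powerSum_liCoeff_one (by rw [norm_pathOne ht]; linarith), e, norm_neg,
      ← Complex.ofReal_log ht.1.le, Complex.norm_real, one_mul]
  refine (hO.mul (isBigO_altFun_pathOne j)).trans_tendsto ?_
  simpa using tendsto_log_mul_rpow_nhdsGT_zero zero_lt_one

/-! ### Limits of the three functions at both ends. -/

lemma tendsto_productSum_pathOne (m : ℕ) :
    Tendsto (fun t => productSum m (pathOne t)) (𝓝[>] 0) (𝓝 0) := by
  have h : ∀ r ∈ range (m + 1), Tendsto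
      (fun t => liOdd (r + 1) (pathOne t) * altFun (m + 1 - r) (pathOne t)) (𝓝[>] 0) (𝓝 0) := by
    intro r hr
    obtain ⟨k, hk⟩ : ∃ k, m + 1 - r = k + 1 := ⟨m - r, by have := Finset.mem_range.1 hr; omega⟩
    rw [hk]
    have hneg := (tendsto_powerSum_neg_pathOne (tendsto_multiLi_single
      (multiLiConverges_single (s := r + 1) (by omega) (by simp) neg_one_ne_one))).mul
      (tendsto_altFun_pathOne k)
    have hpos : Tendsto (fun t => powerSum (liCoeff (r + 1)) (pathOne t)
        * altFun (k + 1) (pathOne t)) (𝓝[>] 0) (𝓝 0) := by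
      rcases Nat.eq_zero_or_pos r with rfl | hr0
      · exact tendsto_li_one_mul_altFun k
      · simpa using (tendsto_powerSum_pathOne (tendsto_multiLi_single
          (multiLiConverges_single_of_two_le (s := r + 1) (x := 1) (by omega) (by simp)))).mul
          (tendsto_altFun_pathOne k)
    simpa [liOdd, sub_mul] using hneg.sub hpos
  simpa [productSum] using tendsto_finsetSum (range (m + 1)) h

lemma tendsto_sFun_pathOne (m : ℕ) :
    Tendsto (fun t => sFun m (pathOne t)) (𝓝[>] 0) (𝓝 0) := by
  have h := (hasDerivAt_powerSum_nat_mul (linearlyBounded_altCoeff (m + 1))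
    (nat_mul_altCoeff_div m) (z := 0) (by simp)).continuousAt.tendsto
  rw [powerSum_zero (by simp)] at h
  exact h.comp tendsto_cayley_pathOne

/-- The variable is absorbed into the first argument: with `x = -1`, the endpoints `ζ = 1` and `ζ =
-i` give `Li_{1,s}(-1, y)` and `Li_{1,s}(i, y)`. -/
lemma liTwoCoeff_mul_pow (x y ζ : ℂ) (s n : ℕ) :
    liTwoCoeff x y s n * ζ ^ n = liTwoCoeff (x * ζ) y s n := by
  rw [liTwoCoeff, liTwoCoeff, mul_pow]
  ring

lemma tendsto_liTwoCoeff {s : ℕ} (hs : 2 ≤ s) {y ζ x : ℂ} (hy : ‖y‖ ≤ 1) (hζ : ‖ζ‖ = 1)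
    (hx : -1 * ζ = x) (h1 : x ≠ 1) :
    Tendsto (fun N => ∑ n ∈ range N, liTwoCoeff (-1) y s n * ζ ^ n) atTop
      (𝓝 (multiLi [(1, x), (s, y)])) := by
  simp only [liTwoCoeff_mul_pow, hx]
  exact tendsto_multiLi_pair (multiLiConverges_pair hs (by simp [← hx, hζ]) h1 hy)

lemma tendsto_liDepthTwo_pathOne {m : ℕ} (hm : 1 ≤ m) :
    Tendsto (fun t => liDepthTwo m (pathOne t)) (𝓝[>] 0)
      (𝓝 (multiLi [(m + 2, 1)] - multiLi [(m + 2, -1)]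
        + 2 * multiLi [(1, -1), (m + 1, -1)] - 2 * multiLi [(1, -1), (m + 1, 1)])) := by
  have hm2 : 2 ≤ m + 1 := by omega
  exact (((tendsto_powerSum_pathOne (tendsto_multiLi_single
    (multiLiConverges_single_of_two_le (by omega) (by simp)))).sub
    (tendsto_powerSum_neg_pathOne (tendsto_multiLi_single
    (multiLiConverges_single_of_two_le (by omega) (by simp))))).add
    ((tendsto_powerSum_pathOne (tendsto_liTwoCoeff hm2 (by simp) (by simp) (by simp)
      neg_one_ne_one)).const_mul 2)).sub
    ((tendsto_powerSum_pathOne (tendsto_liTwoCoeff hm2 (by simp) (by simp) (by simp)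
      neg_one_ne_one)).const_mul 2)

lemma tendsto_liDepthTwo_pathNegI {m : ℕ} (hm : 1 ≤ m) :
    Tendsto (fun t => liDepthTwo m (pathNegI t)) (𝓝[>] 0)
      (𝓝 (multiLi [(m + 2, -Complex.I)] - multiLi [(m + 2, Complex.I)]
        + 2 * multiLi [(1, Complex.I), (m + 1, -1)]
        - 2 * multiLi [(1, Complex.I), (m + 1, 1)])) := by
  have hm2 : 2 ≤ m + 1 := by omega
  exact (((tendsto_powerSum_pathNegI (tendsto_multiLi_single
    (multiLiConverges_single_of_two_le (by omega) (by simp)))).sub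
    (tendsto_powerSum_neg_pathNegI (tendsto_multiLi_single
    (multiLiConverges_single_of_two_le (by omega) (by simp))))).add
    ((tendsto_powerSum_pathNegI (tendsto_liTwoCoeff hm2 (by simp) (by simp) (by simp)
      I_ne_one)).const_mul 2)).sub
    ((tendsto_powerSum_pathNegI (tendsto_liTwoCoeff hm2 (by simp) (by simp) (by simp)
      I_ne_one)).const_mul 2)

lemma tendsto_liOdd_pathNegI (r : ℕ) :
    Tendsto (fun t => liOdd (r + 1) (pathNegI t)) (𝓝[>] 0)
      (𝓝 (2 * Complex.I * (dirichletBeta (r + 1) : ℂ))) := by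
  rw [two_I_mul_dirichletBeta (by omega)]
  exact (tendsto_powerSum_neg_pathNegI (tendsto_multiLi_single
    (multiLiConverges_single (by omega) (by simp) I_ne_one))).sub
    (tendsto_powerSum_pathNegI (tendsto_multiLi_single
    (multiLiConverges_single (by omega) (by simp) neg_I_ne_one)))

lemma tendsto_altFun_pathNegI (j : ℕ) :
    Tendsto (fun t => altFun (j + 1) (pathNegI t)) (𝓝[>] 0)
      (𝓝 (logLi (j + 1) (Complex.I * (Real.pi : ℂ) / 2) (multiLi [(j + 1, Complex.I)]))) := by
  have hlog : Tendsto (fun t => -Complex.log (pathNegI t)) (𝓝[>] 0)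
      (𝓝 (Complex.I * (Real.pi : ℂ) / 2)) := by
    have h := ((Complex.hasDerivAt_log (z := -Complex.I)
      (by simp [Complex.mem_slitPlane_iff])).continuousAt.tendsto.comp tendsto_pathNegI).neg
    rwa [Complex.log_neg_I, show -(-(Real.pi / 2 : ℂ) * Complex.I)
      = Complex.I * (Real.pi : ℂ) / 2 by ring] at h
  have hli := tendsto_powerSum_neg_pathNegI (tendsto_multiLi_single
    (multiLiConverges_single (s := j + 1) (by omega) (by simp) I_ne_one))
  refine (((continuous_logLi (j + 1)).tendsto _).comp (hlog.prodMk_nhds hli)).congr' ?_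
  filter_upwards [pathNegI_mem_lens] with t ht
  exact (altFun_eq_logLi (j + 1) _ ht).symm

lemma tendsto_productSum_pathNegI (m : ℕ) :
    Tendsto (fun t => productSum m (pathNegI t)) (𝓝[>] 0)
      (𝓝 (∑ r ∈ range (m + 1), 2 * Complex.I * (dirichletBeta (r + 1) : ℂ)
        * logLi (m - r + 1) (Complex.I * (Real.pi : ℂ) / 2)
          (multiLi [(m - r + 1, Complex.I)]))) := by
  refine tendsto_finsetSum (range (m + 1)) fun r hr => ?_
  rw [show m + 1 - r = m - r + 1 by have := Finset.mem_range.1 hr; omega]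
  exact (tendsto_liOdd_pathNegI r).mul (tendsto_altFun_pathNegI (m - r))

/-! ### Reindexing and assembly. -/

lemma sum_antidiagonalTuple_three (m : ℕ) (f : ℕ → ℕ → ℕ → ℂ) :
    ∑ t ∈ Finset.Nat.antidiagonalTuple 3 m, f (t 0) (t 1) (t 2)
      = ∑ r ∈ range (m + 1), ∑ p ∈ range (m - r + 1), f (m - r - p) p r := by
  rw [Finset.sum_sigma']
  refine Finset.sum_bij' (fun t _ => ⟨t 2, t 1⟩) (fun q _ => ![m - q.1 - q.2, q.2, q.1])
    ?_ ?_ ?_ ?_ ?_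
  · intro t ht
    rw [Finset.Nat.mem_antidiagonalTuple, Fin.sum_univ_three] at ht
    simp only [Finset.mem_sigma, Finset.mem_range]
    omega
  · intro q hq
    simp only [Finset.mem_sigma, Finset.mem_range] at hq
    rw [Finset.Nat.mem_antidiagonalTuple, Fin.sum_univ_three]
    simp
    omega
  · intro t ht
    rw [Finset.Nat.mem_antidiagonalTuple, Fin.sum_univ_three] at ht
    funext i
    fin_cases i
    · simp; omega
    · rfl
    · rfl
  · intro q _
    rfl
  · intro t ht
    rw [Finset.Nat.mem_antidiagonalTuple, Fin.sum_univ_three] at ht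
    rw [show m - t 2 - t 1 = t 0 by omega]

lemma sum_antidiagonal_eq_sum_range (m : ℕ) (f : ℕ → ℕ → ℂ) :
    ∑ t ∈ Finset.HasAntidiagonal.antidiagonal m, f t.1 t.2
      = ∑ r ∈ range (m + 1), f (m - r) r := by
  rw [← Finset.sum_range_reflect, Finset.Nat.sum_antidiagonal_eq_sum_range_succ f]
  refine Finset.sum_congr rfl fun r hr => ?_
  have := Finset.mem_range.1 hr
  rw [show m - (m + 1 - 1 - r) = r by omega, show m + 1 - 1 - r = m - r by omega]

/-- The value at `x = i` of the generating function of the multiple `S` values. -/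
lemma limit_sFun_eq {m : ℕ} (hm : 1 ≤ m) {L : ℂ}
    (hL : Tendsto (fun N => ∑ n ∈ range N, altCoeff (m + 1) n / n * Complex.I ^ n) atTop (𝓝 L)) :
    L = (∑ r ∈ range (m + 1), 2 * Complex.I * (dirichletBeta (r + 1) : ℂ)
        * logLi (m - r + 1) (Complex.I * (Real.pi : ℂ) / 2) (multiLi [(m - r + 1, Complex.I)]))
      + 2 * Complex.I * (dirichletBeta (m + 2) : ℂ)
      - multiLi [(m + 2, -1)] + multiLi [(m + 2, 1)]
      - 2 * multiLi [(1, Complex.I), (m + 1, -1)]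
      + 2 * multiLi [(1, Complex.I), (m + 1, 1)]
      + 2 * multiLi [(1, -1), (m + 1, -1)]
      - 2 * multiLi [(1, -1), (m + 1, 1)] := by
  have h1 := ((tendsto_sFun_pathOne m).sub (tendsto_productSum_pathOne m)).add
    (tendsto_liDepthTwo_pathOne hm)
  have h2 := ((tendsto_powerSum_cayley_pathNegI hL).sub (tendsto_productSum_pathNegI m)).add
    (tendsto_liDepthTwo_pathNegI hm)
  obtain ⟨t, ht⟩ := pathOne_mem_lens.exists
  -- Comparison with the zero function expresses the constant value at one interior point through
  -- the limit at `1`, then through the limit at `-i`.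
  have e1 := eq_of_hasDerivAt_eq (fun v hv => hasDerivAt_sFun_sub_productSum m hv)
    (fun v _ => hasDerivAt_const v (0 : ℂ)) pathOne_mem_lens h1 tendsto_const_nhds ht
  have e2 := eq_of_hasDerivAt_eq (fun v hv => hasDerivAt_sFun_sub_productSum m hv)
    (fun v _ => hasDerivAt_const v (0 : ℂ)) pathNegI_mem_lens h2 tendsto_const_nhds ht
  rw [two_I_mul_dirichletBeta (by omega : 1 ≤ m + 2)]
  linear_combination e1 - e2

lemma sum_mul_logLi (m : ℕ) (ℓ : ℂ) :
    ∑ r ∈ range (m + 1), 2 * Complex.I * (dirichletBeta (r + 1) : ℂ)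
        * logLi (m - r + 1) ℓ (multiLi [(m - r + 1, Complex.I)])
      = (∑ t ∈ Finset.HasAntidiagonal.antidiagonal m,
            2 * Complex.I * (-1) ^ (t.1 + 1) * (dirichletBeta (t.2 + 1) : ℂ) *
              (2 * multiLi [(t.1 + 1, Complex.I)]))
          + (∑ t ∈ Finset.HasAntidiagonal.antidiagonal m,
              2 * Complex.I * (dirichletBeta (t.2 + 1) : ℂ) *
                (1 / ((t.1 + 1).factorial : ℂ)) * ℓ ^ (t.1 + 1))
          - (∑ t ∈ Finset.Nat.antidiagonalTuple 3 m,
              2 * Complex.I * (-1) ^ (t 1 + 1) * (dirichletBeta (t 2 + 1) : ℂ) *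
                (2 * multiLi [(t 1 + 1, -1)]) *
                  (1 / ((t 0).factorial : ℂ)) * ℓ ^ (t 0)) := by
  rw [sum_antidiagonal_eq_sum_range m fun p r =>
      2 * Complex.I * (-1) ^ (p + 1) * (dirichletBeta (r + 1) : ℂ) *
        (2 * multiLi [(p + 1, Complex.I)]),
    sum_antidiagonal_eq_sum_range m fun k r =>
      2 * Complex.I * (dirichletBeta (r + 1) : ℂ) * (1 / ((k + 1).factorial : ℂ)) * ℓ ^ (k + 1),
    sum_antidiagonalTuple_three m fun k p r =>
      2 * Complex.I * (-1) ^ (p + 1) * (dirichletBeta (r + 1) : ℂ) *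
        (2 * multiLi [(p + 1, -1)]) * (1 / (k.factorial : ℂ)) * ℓ ^ k,
    ← Finset.sum_add_distrib, ← Finset.sum_sub_distrib]
  refine Finset.sum_congr rfl fun r _ => ?_
  rw [logLi, mul_sub, Finset.mul_sum]
  congr 1
  · ring
  · refine Finset.sum_congr rfl fun p _ => ?_
    rw [Nat.add_sub_cancel]
    ring

end AltMixed

theorem mainTheorem6 (m : ℕ) (hm : 1 ≤ m) :
    (MultiSConverges (argsBarTwoOnes m) ∧
      (∀ s : ℕ, 1 ≤ s → DirichletBetaConverges s) ∧
      (∀ s : ℕ, 1 ≤ s → MultiLiConverges [(s, Complex.I)]) ∧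
      (∀ s : ℕ, 1 ≤ s → MultiLiConverges [(s, -1)]) ∧
      MultiLiConverges [(m + 2, 1)] ∧
      MultiLiConverges [(1, Complex.I), (m + 1, -1)] ∧
      MultiLiConverges [(1, Complex.I), (m + 1, 1)] ∧
      MultiLiConverges [(1, -1), (m + 1, -1)] ∧
      MultiLiConverges [(1, -1), (m + 1, 1)]) ∧
    (multiS (argsBarTwoOnes m) : ℂ) =
      Complex.I ^ (if Odd m then 1 else 0) *
        ((∑ t ∈ Finset.HasAntidiagonal.antidiagonal m,
            2 * Complex.I * (-1) ^ (t.1 + 1) * (dirichletBeta (t.2 + 1) : ℂ) *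
              (2 * multiLi [(t.1 + 1, Complex.I)]))
          + (∑ t ∈ Finset.HasAntidiagonal.antidiagonal m,
              2 * Complex.I * (dirichletBeta (t.2 + 1) : ℂ) *
                (1 / ((t.1 + 1).factorial : ℂ)) *
                  (Complex.I * (Real.pi : ℂ) / 2) ^ (t.1 + 1))
          - (∑ t ∈ Finset.Nat.antidiagonalTuple 3 m,
              2 * Complex.I * (-1) ^ (t 1 + 1) * (dirichletBeta (t 2 + 1) : ℂ) *
                (2 * multiLi [(t 1 + 1, -1)]) *
                  (1 / ((t 0).factorial : ℂ)) * (Complex.I * (Real.pi : ℂ) / 2) ^ (t 0))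
          + 2 * Complex.I * (dirichletBeta (m + 2) : ℂ)
          - multiLi [(m + 2, -1)] + multiLi [(m + 2, 1)]
          - 2 * multiLi [(1, Complex.I), (m + 1, -1)]
          + 2 * multiLi [(1, Complex.I), (m + 1, 1)]
          + 2 * multiLi [(1, -1), (m + 1, -1)]
          - 2 * multiLi [(1, -1), (m + 1, 1)]) := by
  have hm2 : 2 ≤ m + 1 := by omega
  refine ⟨⟨AltMixed.multiSConverges_argsBarTwoOnes hm,
    fun s hs => AltMixed.dirichletBetaConverges hs,
    fun s hs => AltMixed.multiLiConverges_single hs (by simp) AltMixed.I_ne_one,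
    fun s hs => AltMixed.multiLiConverges_single hs (by simp) AltMixed.neg_one_ne_one,
    AltMixed.multiLiConverges_single_of_two_le (by omega) (by simp),
    AltMixed.multiLiConverges_pair hm2 (by simp) AltMixed.I_ne_one (by simp),
    AltMixed.multiLiConverges_pair hm2 (by simp) AltMixed.I_ne_one (by simp),
    AltMixed.multiLiConverges_pair hm2 (by simp) AltMixed.neg_one_ne_one (by simp),
    AltMixed.multiLiConverges_pair hm2 (by simp) AltMixed.neg_one_ne_one (by simp)⟩, ?_⟩
  obtain ⟨L, hL⟩ := AltMixed.exists_tendsto_altCoeff_div m (x := Complex.I) (by simp)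
  rw [AltMixed.multiS_eq_mul_of_tendsto hm hL, AltMixed.limit_sFun_eq hm hL,
    AltMixed.sum_mul_logLi]
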